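/- Let $K=\mathbb F_q$ be a finite field of characteristic $p$, let $m\ge 2$ be an integer with $p\nmid m$, and let $f\in K[x]$ be a separable polynomial of degree $r$ with $\gcd(m,r)=1$. Let $F=K(x,y)$ be the function field defined over the rational function field $K(x)$ by $y^m=f(x)$, let $P_\infty$ denote the pole of $x$ in $F$, and assume that $m=ur+1$ for some integer $u$. For a divisor $D$ of $F$ put $\mathcal L(D)=\{z\in F: (z)\ge -D\}\cup\{0\}$ and $\ell(D)=\dim_K\mathcal L(D)$. For distinct rational places $Q_1,\dots,Q_s$ of $F$, a tuple $(n_1,\dots,n_s)$ of non-negative integers is called a pure gap at $Q_1,\dots,Q_s$ if $\ell\big(\sum_i n_iQ_i\big)=\ell\big(\sum_i n_iQ_i-Q_j\big)$ for all $j\in\{1,\dots,s\}$. Let $P_1\neq P_\infty$ be a rational place of $F$ that is totally ramified in $F/K(x)$. Then: (i) $((r-1)m-2r,\,1)$ is a pure gap at $P_\infty,P_1$, provided that $(r-1)m-2r\ge 0$; (ii) for every $b\in\{1,\dots,u+1\}$, $((r-2)m-r,\,b)$ is a pure gap at $P_\infty,P_1$, provided that $(r-2)m-r\ge 0$. If moreover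 $P_2\ne P_1,P_\infty$ is another rational place of $F$ that is totally ramified in $F/K(x)$, then: (iii) for all $\alpha\in\{0,\dots,2u-1\}$ and $\beta\in\{0,\dots,u-1\}$, $((r-3)m+1+\alpha,\,1+\beta)$ is a pure gap at $P_1,P_2$, provided that $(r-3)m+1+\alpha\ge 0$. -/

import Mathlib

open scoped WithZero Polynomial IntermediateField

namespace AlgFunctionField

/-- A place of the function field `F / K`, given by its normalized discrete valuation: a
surjective valuation `F → ℤ ∪ {∞}` that is trivial on the nonzero constants.  The value group is
written multiplicatively, so with the usual additive normalization `v z = exp (- v_P(z))`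
and `v 0 = 0`. -/
@[ext]
structure Place (K F : Type*) [Field K] [Field F] [Algebra K F] where
  v : Valuation F ℤᵐ⁰
  surj : Function.Surjective v
  trivial_on_constants : ∀ c : K, c ≠ 0 → v (algebraMap K F c) = 1

/-- The group of divisors: the free abelian group on the places. -/
abbrev Divisor (K F : Type*) [Field K] [Field F] [Algebra K F] := Place K F →₀ ℤ

section

variable {K F : Type*} [Field K] [Field F] [Algebra K F]

/-- The place `P` has degree one: its residue field is `K`, that is, every element of the
valuation ring is congruent to a constant modulo the maximal ideal. -/
def Place.IsRational (P : Place K F) : Prop :=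
  ∀ z : F, P.v z ≤ 1 → ∃ c : K, P.v (z - algebraMap K F c) < 1

/-- The place `P` is a pole of `z`, that is, `v_P(z) < 0`. -/
def Place.IsPole (P : Place K F) (z : F) : Prop := 1 < P.v z

/-- The ramification index of `P` over the intermediate field `E`: the index of the value group
of `E` in the value group of `F`. -/
noncomputable def Place.ramificationIdx (P : Place K F) (E : IntermediateField K F) : ℕ :=
  ((Units.map (P.v : F →* ℤᵐ⁰)).comp (Units.map (algebraMap E F : E →* F))).range.index

/-- `P` is totally ramified in the (finite) extension `F / E`: its ramification index over `E` is
the degree `[F : E]`. -/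
def Place.IsTotallyRamified (P : Place K F) (E : IntermediateField K F) : Prop :=
  P.ramificationIdx E = Module.finrank E F

lemma Place.v_algebraMap_le_one (P : Place K F) (c : K) : P.v (algebraMap K F c) ≤ 1 := by
  by_cases hc : c = 0
  · simp [hc]
  · exact (P.trivial_on_constants c hc).le

/-- The Riemann-Roch space `L(D) = {z | (z) ≥ - D} ∪ {0}`: the condition `v_P(z) ≥ - D(P)` at
every place `P` reads `v z ≤ exp (D P)`, and it holds for `z = 0`. -/
noncomputable def riemannRochSpace (D : Divisor K F) : Submodule K F where
  carrier := {z | ∀ P : Place K F, P.v z ≤ WithZero.exp (D P)}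
  add_mem' := fun ha hb P => (P.v.map_add _ _).trans (max_le (ha P) (hb P))
  zero_mem' := fun P => by simp
  smul_mem' := fun c z hz P => by
    rw [Algebra.smul_def, map_mul]
    exact (mul_le_of_le_one_left' (P.v_algebraMap_le_one c)).trans (hz P)

/-- `ℓ(D)`, the dimension of `L(D)` over `K`. -/
noncomputable def ell (D : Divisor K F) : ℕ := Module.finrank K (riemannRochSpace D)

/-- The divisor `n₁ P₁ + ⋯ + nₛ Pₛ`. -/
noncomputable def divisorOf {s : ℕ} (P : Fin s → Place K F) (n : Fin s → ℕ) : Divisor K F :=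
  ∑ i, Finsupp.single (P i) (n i : ℤ)

/-- The tuple `n` of natural numbers is a pure gap at the places `P₁, …, Pₛ`:
`ℓ(∑ nᵢ Pᵢ) = ℓ(∑ nᵢ Pᵢ - Pⱼ)` for every `j`. -/
def IsPureGap {s : ℕ} (P : Fin s → Place K F) (n : Fin s → ℕ) : Prop :=
  ∀ j, ell (divisorOf P n) = ell (divisorOf P n - Finsupp.single (P j) 1)

end

end AlgFunctionField

namespace AlgFunctionField

/-! ### Places from primes of the integral closure of `K[x]` -/

section ExistenceOfPlaces

open IsDedekindDomain
open scoped IntermediateField.algebraAdjoinAdjoin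

variable {K F : Type*} [Field K] [Field F] [Algebra K F] (x : F)

/-! Every `z` in `F` is a sum of terms `h_j(x) y ^ j` with `0 ≤ j < m`. Additively, at the pole of
`x` the value of `y` is `-r` and that of a polynomial `g(x)` is `-m deg g`; at a place over a root
`c` of `f` they are `1` and `m` times the multiplicity of `c` in `g`. Since `m` is prime to `r`, the
nonzero terms have values in distinct classes modulo `m`, so nothing cancels: the value of the sum
is the least value of a term (`Place.Separates.sum`). This also shows that `[F : K(x)] = m`, and
that the pole of `x` and the place over each root are unique.

The integral closure of `K[x]` in `F` is `K[x, y]` because `f` is squarefree and `m` is invertible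
(`exists_eq_sum_of_isIntegral`). Hence a function whose finite poles lie over roots of `f` becomes,
after multiplication by suitable powers of the factors `x - c`, a sum of `g_j(x) y ^ j` with
polynomial `g_j`, and each bound on its divisor becomes a linear inequality in `j`, `deg g_j` and
root multiplicities, for each `j` separately.

A pair is a pure gap when no function in the Riemann-Roch space attains its bound at either place.
Attaining it means equality for some `j`; that pins down `j`, and `m = ur + 1` makes another
inequality fail for this `j`. A totally ramified rational place other than the pole does lie over a
root of `f`: otherwise `y` would be a `P`-adic limit of elements of `K(x)`, and `P` would be
unramified. -/

lemma isDedekindDomain_adjoin (hx : Transcendental K x) :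
    IsDedekindDomain (Algebra.adjoin K {x}) := by
  have : IsPrincipalIdealRing (Algebra.adjoin K {x}) :=
    IsPrincipalIdealRing.of_surjective (Polynomial.algEquivOfTranscendental K x hx).toRingEquiv
      (Polynomial.algEquivOfTranscendental K x hx).surjective
  infer_instance

/-- The place attached to a nonzero prime ideal of a Dedekind domain with fraction field `F`. -/
noncomputable def Place.ofHeightOneSpectrum {B : Type*} [CommRing B] [IsDedekindDomain B]
    [Algebra K B] [Algebra B F] [IsScalarTower K B F] [IsFractionRing B F]
    (𝔭 : HeightOneSpectrum B) : Place K F where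
  v := 𝔭.valuation F
  surj := 𝔭.valuation_surjective F
  trivial_on_constants c hc := by
    rw [IsScalarTower.algebraMap_apply K B F, HeightOneSpectrum.valuation_eq_one_iff_notMem]
    exact fun h => 𝔭.isPrime.ne_top
      (Ideal.eq_top_of_isUnit_mem _ h ((IsUnit.mk0 c hc).map (algebraMap K B)))

variable [FiniteDimensional K⟮x⟯ F] [Algebra.IsSeparable K⟮x⟯ F]

/-- The integral closure of `K[x]` is Dedekind with fraction field `F`, so it is the intersection of
its localizations; each of its nonzero primes gives a place where `x` is integral. -/
lemma isIntegral_of_forall_place_le_one (hx : Transcendental K x) (z : F)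
    (hz : ∀ P : Place K F, P.v x ≤ 1 → P.v z ≤ 1) : IsIntegral (Algebra.adjoin K {x}) z := by
  have := isDedekindDomain_adjoin x hx
  have := integralClosure.isDedekindDomain (Algebra.adjoin K {x}) K⟮x⟯ F
  have := integralClosure.isFractionRing_of_finite_extension (A := Algebra.adjoin K {x}) K⟮x⟯ F
  have key := HeightOneSpectrum.mem_integers_of_valuation_le_one
    (R := integralClosure (Algebra.adjoin K {x}) F) F z fun 𝔭 =>
      hz (Place.ofHeightOneSpectrum 𝔭) (𝔭.valuation_le_one
        (⟨x, isIntegral_algebraMap (A := F)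
          (x := (⟨x, Algebra.self_mem_adjoin_singleton K x⟩ : Algebra.adjoin K {x}))⟩ :
          integralClosure (Algebra.adjoin K {x}) F))
  obtain ⟨w, rfl⟩ := key
  exact w.2

/-- Lying over: a maximal ideal of `K[x]` containing `t` is the contraction of one of the integral
closure. -/
lemma exists_place_lt_one (hx : Transcendental K x) (t : Algebra.adjoin K {x}) (ht0 : t ≠ 0)
    (ht : ¬ IsUnit t) : ∃ P : Place K F, P.v x ≤ 1 ∧ P.v (t : F) < 1 := by
  have := isDedekindDomain_adjoin x hx
  have := integralClosure.isDedekindDomain (Algebra.adjoin K {x}) K⟮x⟯ F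
  have := integralClosure.isFractionRing_of_finite_extension (A := Algebra.adjoin K {x}) K⟮x⟯ F
  have : FaithfulSMul (Algebra.adjoin K {x}) (integralClosure (Algebra.adjoin K {x}) F) :=
    (faithfulSMul_iff_algebraMap_injective _ _).2 fun a b h =>
      Subtype.ext (congrArg (algebraMap (integralClosure (Algebra.adjoin K {x}) F) F) h)
  obtain ⟨M, hM, htM⟩ := exists_max_ideal_of_mem_nonunits ht
  obtain ⟨Q, hQ, hQM⟩ := Ideal.exists_maximal_ideal_liesOver_of_isIntegral
    (S := integralClosure (Algebra.adjoin K {x}) F) M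
  have htQ : algebraMap _ (integralClosure (Algebra.adjoin K {x}) F) t ∈ Q := by
    rw [← Ideal.mem_comap, ← Ideal.under_def, ← hQM.over]; exact htM
  have hQ0 : Q ≠ ⊥ := by
    rintro rfl
    exact ht0 (by simpa using htQ)
  let 𝔭 : HeightOneSpectrum (integralClosure (Algebra.adjoin K {x}) F) := ⟨Q, hQ.isPrime, hQ0⟩
  exact ⟨Place.ofHeightOneSpectrum 𝔭, 𝔭.valuation_le_one (algebraMap _ _
    (⟨x, Algebra.self_mem_adjoin_singleton K x⟩ : Algebra.adjoin K {x})),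
    (𝔭.valuation_lt_one_iff_mem (K := F) _).2 htQ⟩

end ExistenceOfPlaces

section Pole

variable {K F : Type*} [Field K] [Field F] [Algebra K F] (x : F)

lemma adjoin_inv_eq : K⟮x⁻¹⟯ = K⟮x⟯ := by
  apply le_antisymm <;> rw [IntermediateField.adjoin_simple_le_iff]
  · exact inv_mem (IntermediateField.mem_adjoin_simple_self K x)
  · simpa using inv_mem (IntermediateField.mem_adjoin_simple_self K x⁻¹)

/-- A pole of `x` is a zero of `x⁻¹`, which generates the same subfield. -/
lemma exists_isPole [hfin : FiniteDimensional K⟮x⟯ F] [hsep : Algebra.IsSeparable K⟮x⟯ F]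
    (hx : Transcendental K x) : ∃ P : Place K F, P.IsPole x := by
  have hx0 : x ≠ 0 := fun h => hx (h ▸ isAlgebraic_zero)
  have hx' : Transcendental K x⁻¹ := fun h => hx (by simpa using h.inv)
  rw [← adjoin_inv_eq x] at hfin hsep
  obtain ⟨P, -, hP⟩ := exists_place_lt_one x⁻¹ hx'
    ⟨x⁻¹, Algebra.self_mem_adjoin_singleton K _⟩ (by simpa [Subtype.ext_iff] using hx0) (by
      intro h
      have := h.map (Polynomial.algEquivOfTranscendental K x⁻¹ hx').symm
      rw [Polynomial.algEquivOfTranscendental_symm_gen] at this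
      exact Polynomial.not_isUnit_X this)
  refine ⟨P, ?_⟩
  rw [map_inv₀] at hP
  exact (inv_lt_one₀ (zero_lt_iff.2 ((P.v.ne_zero_iff).2 hx0))).1 hP

end Pole

end AlgFunctionField

namespace AlgFunctionField

/-! ### Values of polynomials in `x` -/

section PlaceValues

variable {K F : Type*} [Field K] [Field F] [Algebra K F] (P : Place K F)

instance : P.v.IsTrivialOn K := ⟨P.trivial_on_constants⟩

lemma Place.exists_v_eq_exp {z : F} (hz : z ≠ 0) : ∃ k : ℤ, P.v z = WithZero.exp k :=
  ⟨_, (WithZero.exp_log ((P.v.ne_zero_iff).2 hz)).symm⟩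

lemma Place.v_le_exp_sub_one {z : F} {k : ℤ} (h : P.v z < WithZero.exp k) :
    P.v z ≤ WithZero.exp (k - 1) := by
  by_cases hz : z = 0
  · simp [hz]
  · obtain ⟨l, hl⟩ := P.exists_v_eq_exp hz
    rw [hl, WithZero.exp_lt_exp] at h
    rw [hl, WithZero.exp_le_exp]
    omega

lemma Place.v_aeval_le_one {x : F} (hx : P.v x ≤ 1) (g : K[X]) :
    P.v (Polynomial.aeval x g) ≤ 1 := by
  rw [Polynomial.aeval_eq_sum_range]
  refine P.v.map_sum_le fun i _ => ?_
  rw [Algebra.smul_def, map_mul, map_pow]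
  exact mul_le_one' (P.v_algebraMap_le_one _) (pow_le_one' hx _)

/-- In a Bézout relation `a π + b g = 1` both terms would otherwise lie in the maximal ideal. -/
lemma Place.v_aeval_eq_one {x : F} (hx : P.v x ≤ 1) {π g : K[X]} (hπ : Irreducible π)
    (hπ1 : P.v (Polynomial.aeval x π) < 1) (hg : ¬ π ∣ g) : P.v (Polynomial.aeval x g) = 1 := by
  obtain ⟨a, b, hab⟩ := hπ.coprime_iff_not_dvd.2 hg
  refine le_antisymm (P.v_aeval_le_one hx g) (le_of_not_gt fun h => ?_)
  have h1 : P.v (Polynomial.aeval x (a * π + b * g)) < 1 := by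
    rw [map_add, map_mul, map_mul]
    refine P.v.map_add_lt ?_ ?_ <;> rw [map_mul]
    · exact mul_lt_one_of_nonneg_of_lt_one_right (P.v_aeval_le_one hx a) zero_le hπ1
    · exact mul_lt_one_of_nonneg_of_lt_one_right (P.v_aeval_le_one hx b) zero_le h
  simp [hab] at h1

end PlaceValues

/-! ### Places at which the powers of `y` cannot cancel -/

section Separates

variable {K F : Type*} [Field K] [Field F] [Algebra K F]

/-- The values at `P` of the powers `y ^ i`, `0 ≤ i < m`, lie in distinct classes modulo the
value group of `K(x)`. -/
def Place.Separates (P : Place K F) (x y : F) (m : ℕ) : Prop :=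
  ∀ h : K⟮x⟯, h ≠ 0 → ∀ i : ℕ, 0 < i → i < m → P.v ((h : F) * y ^ i) ≠ 1

variable {P : Place K F} {x y : F} {m : ℕ}

lemma Place.Separates.ne (hP : P.Separates x y m) (hy : y ≠ 0) {g h : K⟮x⟯} (hg : g ≠ 0)
    (hh : h ≠ 0) {i j : ℕ} (hi : i < m) (hj : j < m) (hij : i ≠ j) :
    P.v ((g : F) * y ^ i) ≠ P.v ((h : F) * y ^ j) := by
  wlog hlt : i < j generalizing i j g h
  · exact (this hh hg hj hi hij.symm (by omega)).symm
  intro heq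
  refine hP (h / g) (div_ne_zero hh hg) (j - i) (by omega) (by omega) ?_
  have hg' : (g : F) ≠ 0 := by simpa using hg
  have : ((h / g : K⟮x⟯) : F) * y ^ (j - i) = (h : F) * y ^ j / ((g : F) * y ^ i) := by
    rw [IntermediateField.coe_div, pow_sub₀ _ hy hlt.le]
    field_simp
  rw [this, map_div₀, heq, div_self]
  rw [← heq]
  exact (P.v.ne_zero_iff).2 (mul_ne_zero hg' (pow_ne_zero _ hy))

/-- Nonzero terms have pairwise different values, so the ultrametric inequality is an equality. -/
lemma Place.Separates.sum (hP : P.Separates x y m) (hy : y ≠ 0) (hm : 0 < m)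
    (h : Fin m → K⟮x⟯) :
    ∃ i, P.v (∑ j, (h j : F) * y ^ (j : ℕ)) = P.v ((h i : F) * y ^ (i : ℕ)) ∧
      ∀ j, P.v ((h j : F) * y ^ (j : ℕ)) ≤ P.v ((h i : F) * y ^ (i : ℕ)) := by
  obtain ⟨i, -, hi⟩ := Finset.exists_max_image Finset.univ
    (fun j : Fin m => P.v ((h j : F) * y ^ (j : ℕ))) ⟨⟨0, hm⟩, Finset.mem_univ _⟩
  refine ⟨i, ?_, fun j => hi j (Finset.mem_univ _)⟩
  by_cases h0 : h i = 0
  · refine le_antisymm (P.v.map_sum_le hi) ?_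
    simp [h0]
  · refine P.v.map_sum_eq_of_lt (Finset.mem_univ i) fun j hj => ?_
    refine lt_of_le_of_ne (hi j (Finset.mem_univ _)) ?_
    have hji : j ≠ i := by simpa using hj
    by_cases hj0 : h j = 0
    · have : P.v ((h i : F) * y ^ (i : ℕ)) ≠ 0 :=
        (P.v.ne_zero_iff).2 (mul_ne_zero (by simpa using h0) (pow_ne_zero _ hy))
      simpa [hj0] using this.symm
    · exact hP.ne hy hj0 h0 j.2 i.2 (by simpa [Fin.ext_iff] using hji)

lemma Place.Separates.le_sum (hP : P.Separates x y m) (hy : y ≠ 0) (h : Fin m → K⟮x⟯)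
    (j : Fin m) :
    P.v ((h j : F) * y ^ (j : ℕ)) ≤ P.v (∑ j, (h j : F) * y ^ (j : ℕ)) := by
  obtain ⟨i, hi, hij⟩ := hP.sum hy (lt_of_le_of_lt (Nat.zero_le _) j.2) h
  exact hi ▸ hij j

lemma Place.Separates.eq_zero (hP : P.Separates x y m) (hy : y ≠ 0) {h : Fin m → K⟮x⟯}
    (hs : ∑ j, (h j : F) * y ^ (j : ℕ) = 0) (j : Fin m) : h j = 0 := by
  have := hP.le_sum hy h j
  simpa [hs, hy] using this

/-- Two places separating the powers of `y` agree if they agree on `K(x)` and on `y`. -/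
lemma Place.Separates.eq_of_forall {Q : Place K F} (hP : P.Separates x y m)
    (hQ : Q.Separates x y m) (hy : y ≠ 0) (hm : 0 < m)
    (hspan : ∀ z : F, ∃ h : Fin m → K⟮x⟯, z = ∑ j, (h j : F) * y ^ (j : ℕ))
    (hE : ∀ h : K⟮x⟯, P.v (h : F) = Q.v (h : F)) (hyv : P.v y = Q.v y) : P = Q := by
  ext z
  obtain ⟨h, rfl⟩ := hspan z
  have hterm : ∀ j : Fin m, P.v ((h j : F) * y ^ (j : ℕ)) = Q.v ((h j : F) * y ^ (j : ℕ)) := by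
    intro j
    rw [map_mul, map_mul, map_pow, map_pow, hE, hyv]
  obtain ⟨i, hi, -⟩ := hP.sum hy hm h
  obtain ⟨j, hj, -⟩ := hQ.sum hy hm h
  refine le_antisymm ?_ ?_
  · rw [hi, hterm]
    exact hQ.le_sum hy h i
  · rw [hj, ← hterm]
    exact hP.le_sum hy h j

/-- A relation `m k + e i = 0` forces `m ∣ i`. The common factor `t` is not yet known to be a unit
when the values are first computed; `Place.isUnit_of_values` removes it. -/
lemma Place.separates_of_values {t e : ℤ} (ht : t ≠ 0) (he : IsCoprime (m : ℤ) e)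
    (hE : ∀ h : K⟮x⟯, h ≠ 0 → ∃ k : ℤ, P.v (h : F) = WithZero.exp (m * t * k))
    (hy : P.v y = WithZero.exp (t * e)) : P.Separates x y m := by
  intro h hh i hi him heq
  obtain ⟨k, hk⟩ := hE h hh
  rw [map_mul, map_pow, hk, hy, ← WithZero.exp_nsmul, ← WithZero.exp_add, WithZero.exp_eq_one] at heq
  have h1 : t * (m * k + e * i) = 0 := by rw [nsmul_eq_mul] at heq; linarith
  have h2 : (m : ℤ) * k + e * i = 0 := (mul_eq_zero.1 h1).resolve_left ht
  have h3 : (m : ℤ) ∣ e * i := ⟨-k, by linarith⟩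
  have h4 : m ∣ i := by exact_mod_cast he.dvd_of_dvd_mul_left h3
  exact absurd (Nat.le_of_dvd hi h4) (by omega)

/-- Every value on `F` is that of a single term, hence a multiple of `t`; the valuation is
normalized, so `1` is such a multiple. -/
lemma Place.isUnit_of_values {t e : ℤ} (hm : 0 < m) (hy0 : y ≠ 0)
    (hspan : ∀ z : F, ∃ h : Fin m → K⟮x⟯, z = ∑ j, (h j : F) * y ^ (j : ℕ))
    (hE : ∀ h : K⟮x⟯, h ≠ 0 → ∃ k : ℤ, P.v (h : F) = WithZero.exp (m * t * k))
    (hy : P.v y = WithZero.exp (t * e)) (hP : P.Separates x y m) : IsUnit t := by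
  obtain ⟨z, hz⟩ := P.surj (WithZero.exp 1)
  obtain ⟨h, rfl⟩ := hspan z
  obtain ⟨i, hi, -⟩ := hP.sum hy0 hm h
  have hi0 : h i ≠ 0 := by
    intro h0
    rw [h0, hz] at hi
    simp at hi
  obtain ⟨k, hk⟩ := hE _ hi0
  rw [hz, map_mul, map_pow, hk, hy, ← WithZero.exp_nsmul, ← WithZero.exp_add,
    WithZero.exp_inj, nsmul_eq_mul] at hi
  exact IsUnit.of_mul_eq_one (m * k + i * e) (by linarith)

lemma Place.exists_v_eq_of_aeval {a : ℤ}
    (hE : ∀ g : K[X], g ≠ 0 → ∃ k : ℤ, P.v (Polynomial.aeval x g) = WithZero.exp (a * k))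
    (h : K⟮x⟯) (hh : h ≠ 0) : ∃ k : ℤ, P.v (h : F) = WithZero.exp (a * k) := by
  obtain ⟨g₁, g₂, hg⟩ := (IntermediateField.mem_adjoin_simple_iff K (h : F)).1 h.2
  have h0 : (h : F) ≠ 0 := by simpa using hh
  obtain ⟨k₁, hk₁⟩ := hE g₁ (by rintro rfl; simp [hg] at h0)
  obtain ⟨k₂, hk₂⟩ := hE g₂ (by rintro rfl; simp [hg] at h0)
  exact ⟨k₁ - k₂, by rw [hg, map_div₀, hk₁, hk₂, ← WithZero.exp_sub, mul_sub]⟩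

lemma Place.v_eq_of_aeval {Q : Place K F}
    (hE : ∀ g : K[X], g ≠ 0 → P.v (Polynomial.aeval x g) = Q.v (Polynomial.aeval x g))
    (h : K⟮x⟯) : P.v (h : F) = Q.v (h : F) := by
  have hE' : ∀ g : K[X], P.v (Polynomial.aeval x g) = Q.v (Polynomial.aeval x g) := fun g => by
    by_cases hg : g = 0
    · simp [hg]
    · exact hE g hg
  obtain ⟨g₁, g₂, hg⟩ := (IntermediateField.mem_adjoin_simple_iff K (h : F)).1 h.2
  rw [hg, map_div₀, map_div₀, hE', hE']

end Separates

end AlgFunctionField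

namespace AlgFunctionField

/-! ### Local values on `y ^ m = f(x)`, and generation of `F` over `K(x)` -/

section Kummer

variable {K F : Type*} [Field K] [Field F] [Algebra K F] {P : Place K F} {x y : F} {m : ℕ}
  {f : K[X]}

/-- Comparing values in `y ^ m = f(x)` gives `m b = a deg f`, so `a = m t` and `b = t deg f` by
coprimality; normalization then gives `t = 1`. -/
lemma Place.IsPole.values (hP : P.IsPole x) (hm : 0 < m) (hf : f ≠ 0)
    (hmf : Nat.Coprime m f.natDegree) (hxy : y ^ m = Polynomial.aeval x f)
    (hspan : ∀ z : F, ∃ h : Fin m → K⟮x⟯, z = ∑ j, (h j : F) * y ^ (j : ℕ)) :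
    P.v y = WithZero.exp (f.natDegree : ℤ) ∧
      (∀ g : K[X], g ≠ 0 →
        P.v (Polynomial.aeval x g) = WithZero.exp ((m : ℤ) * g.natDegree)) ∧
      P.Separates x y m := by
  have hP' : 1 < P.v x := hP
  have hx0 : x ≠ 0 := by
    rintro rfl
    simp at hP'
  obtain ⟨a, ha⟩ := P.exists_v_eq_exp hx0
  have ha0 : 0 < a := by rwa [ha, ← WithZero.exp_zero, WithZero.exp_lt_exp] at hP'
  have hg : ∀ g : K[X], g ≠ 0 →
      P.v (Polynomial.aeval x g) = WithZero.exp (a * g.natDegree) := fun g hg => by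
    rw [Polynomial.valuation_aeval_eq_valuation_X_pow_natDegree_of_one_lt_valuation_X x hP' hg,
      ha, ← WithZero.exp_nsmul, nsmul_eq_mul, mul_comm]
  have hy0 : y ≠ 0 := by
    rintro rfl
    have := hg f hf
    rw [← hxy, zero_pow hm.ne', map_zero] at this
    exact WithZero.exp_ne_zero this.symm
  obtain ⟨b, hb⟩ := P.exists_v_eq_exp hy0
  have hab : (m : ℤ) * b = a * f.natDegree := by
    have := hg f hf
    rwa [← hxy, map_pow, hb, ← WithZero.exp_nsmul, WithZero.exp_inj, nsmul_eq_mul] at this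
  have hco : IsCoprime (m : ℤ) (f.natDegree : ℤ) := Nat.isCoprime_iff_coprime.2 hmf
  obtain ⟨t, rfl⟩ : (m : ℤ) ∣ a := hco.dvd_of_dvd_mul_right ⟨b, hab.symm⟩
  have hm' : (0 : ℤ) < m := by exact_mod_cast hm
  obtain rfl : b = t * f.natDegree := mul_left_cancel₀ hm'.ne' (by rw [hab, mul_assoc])
  have ht : 0 < t := pos_of_mul_pos_right ha0 hm'.le
  have hE := Place.exists_v_eq_of_aeval (P := P) (x := x) (a := m * t) fun g hg' => ⟨_, hg g hg'⟩
  have hsep := Place.separates_of_values ht.ne' hco hE hb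
  have ht1 : t = 1 := by
    rcases Int.isUnit_iff.1 (Place.isUnit_of_values hm hy0 hspan hE hb hsep) with h | h
    · exact h
    · omega
  subst ht1
  exact ⟨by simpa using hb, by simpa using hg, hsep⟩

/-- Since `π` divides `f` exactly once, the value of `π(x)` is `m` times that of `y`. Factors of any
degree are allowed because the integral closure must be tested at all of them. -/
lemma Place.values_of_factor {π f' : K[X]} (hxP : P.v x ≤ 1) (hπ : Irreducible π)
    (hπP : P.v (Polynomial.aeval x π) < 1) (hx : Transcendental K x) (hff : f = π * f')
    (hf' : ¬ π ∣ f') (hm : 0 < m) (hxy : y ^ m = Polynomial.aeval x f)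
    (hspan : ∀ z : F, ∃ h : Fin m → K⟮x⟯, z = ∑ j, (h j : F) * y ^ (j : ℕ)) :
    P.v y = WithZero.exp (-1 : ℤ) ∧
      (∀ g : K[X], g ≠ 0 →
        P.v (Polynomial.aeval x g) = WithZero.exp (-((m : ℤ) * multiplicity π g))) ∧
      P.Separates x y m := by
  have hinj : ∀ g : K[X], g ≠ 0 → Polynomial.aeval x g ≠ 0 := fun g hg h =>
    hg (transcendental_iff.1 hx g h)
  have hvy : P.v y ^ m = P.v (Polynomial.aeval x π) := by
    rw [← map_pow, hxy, hff, map_mul, map_mul, P.v_aeval_eq_one hxP hπ hπP hf', mul_one]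
  have hy0 : y ≠ 0 := by
    rintro rfl
    rw [map_zero, zero_pow hm.ne'] at hvy
    exact hinj π hπ.ne_zero ((P.v.zero_iff).1 hvy.symm)
  obtain ⟨b, hb⟩ := P.exists_v_eq_exp hy0
  have hvπ : P.v (Polynomial.aeval x π) = WithZero.exp (m * b) := by
    rw [← hvy, hb, ← WithZero.exp_nsmul, nsmul_eq_mul]
  have hm' : (0 : ℤ) < m := by exact_mod_cast hm
  have hb0 : b < 0 := by
    rw [hvπ, ← WithZero.exp_zero, WithZero.exp_lt_exp] at hπP
    by_contra h
    exact absurd (mul_nonneg hm'.le (not_lt.1 h)) (by omega)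
  have hg : ∀ g : K[X], g ≠ 0 →
      P.v (Polynomial.aeval x g) = WithZero.exp (m * b * multiplicity π g) := fun g hg => by
    have hfin : FiniteMultiplicity π g := FiniteMultiplicity.of_not_isUnit hπ.not_isUnit hg
    obtain ⟨c, hc, hπc⟩ := hfin.exists_eq_pow_mul_and_not_dvd
    conv_lhs => rw [hc]
    rw [map_mul, map_mul, P.v_aeval_eq_one hxP hπ hπP hπc, mul_one, map_pow, map_pow, hvπ,
      ← WithZero.exp_nsmul, nsmul_eq_mul, mul_comm]
  have hE := Place.exists_v_eq_of_aeval (P := P) (x := x) (a := m * b) fun g hg' => ⟨_, hg g hg'⟩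
  have hb' : P.v y = WithZero.exp (b * 1) := by rw [hb, mul_one]
  have hsep := Place.separates_of_values hb0.ne isCoprime_one_right hE hb'
  have hb1 : b = -1 := by
    rcases Int.isUnit_iff.1 (Place.isUnit_of_values hm hy0 hspan hE hb' hsep) with h | h
    · omega
    · exact h
  subst hb1
  exact ⟨hb, by simpa using hg, hsep⟩

lemma coe_aeval_gen (g : K[X]) :
    ((Polynomial.aeval (IntermediateField.AdjoinSimple.gen K x) g : K⟮x⟯) : F) =
      Polynomial.aeval x g := by
  have := Polynomial.aeval_algebraMap_apply F (IntermediateField.AdjoinSimple.gen K x) g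
  rw [IntermediateField.AdjoinSimple.algebraMap_gen] at this
  exact this.symm

lemma isIntegral_of_pow_eq_aeval (hm : 0 < m) (hxy : y ^ m = Polynomial.aeval x f) :
    IsIntegral K⟮x⟯ y :=
  ⟨_, Polynomial.monic_X_pow_sub_C
    (Polynomial.aeval (IntermediateField.AdjoinSimple.gen K x) f) hm.ne', by
      rw [← Polynomial.aeval_def, map_sub, map_pow, Polynomial.aeval_X, Polynomial.aeval_C, hxy,
        sub_eq_zero]
      exact (coe_aeval_gen f).symm⟩

lemma adjoin_eq_top_of_adjoin_pair (hF : IntermediateField.adjoin K {x, y} = ⊤) :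
    IntermediateField.adjoin K⟮x⟯ {y} = ⊤ := by
  have h := IntermediateField.adjoin_adjoin_left K ({x} : Set F) {y}
  rw [Set.singleton_union, hF] at h
  rw [eq_top_iff]
  intro z _
  have : z ∈ (IntermediateField.adjoin K⟮x⟯ {y}).restrictScalars K := h ▸ IntermediateField.mem_top
  exact this

lemma finiteDimensional_of_pow_eq (hm : 0 < m) (hxy : y ^ m = Polynomial.aeval x f)
    (hF : IntermediateField.adjoin K {x, y} = ⊤) : FiniteDimensional K⟮x⟯ F := by
  have := IntermediateField.adjoin.finiteDimensional (isIntegral_of_pow_eq_aeval hm hxy)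
  rw [adjoin_eq_top_of_adjoin_pair hF] at this
  exact (IntermediateField.topEquiv (F := K⟮x⟯) (E := F)).toLinearEquiv.finiteDimensional

lemma isSeparable_of_pow_eq (hm : (m : K) ≠ 0) (hf : f ≠ 0) (hx : Transcendental K x)
    (hxy : y ^ m = Polynomial.aeval x f)
    (hF : IntermediateField.adjoin K {x, y} = ⊤) : Algebra.IsSeparable K⟮x⟯ F := by
  have hsep : IsSeparable K⟮x⟯ y := by
    refine Polynomial.Separable.of_dvd (Polynomial.separable_X_pow_sub_C
      (n := m) (Polynomial.aeval (IntermediateField.AdjoinSimple.gen K x) f) ?_ ?_)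
      (minpoly.dvd _ _ ?_)
    · have := (map_ne_zero (algebraMap K K⟮x⟯)).2 hm
      simpa using this
    · intro h
      refine hf (transcendental_iff.1 hx f ?_)
      rw [← coe_aeval_gen, h]
      rfl
    · rw [map_sub, map_pow, Polynomial.aeval_X, Polynomial.aeval_C, hxy, sub_eq_zero]
      exact (coe_aeval_gen f).symm
  have := (IntermediateField.isSeparable_adjoin_simple_iff_isSeparable K⟮x⟯ F).2 hsep
  rw [adjoin_eq_top_of_adjoin_pair hF] at this
  exact AlgEquiv.Algebra.isSeparable (IntermediateField.topEquiv (F := K⟮x⟯) (E := F))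

lemma exists_eq_sum_pow (hm : 0 < m) (hxy : y ^ m = Polynomial.aeval x f)
    (hF : IntermediateField.adjoin K {x, y} = ⊤) (z : F) :
    ∃ h : Fin m → K⟮x⟯, z = ∑ j, (h j : F) * y ^ (j : ℕ) := by
  have hint := isIntegral_of_pow_eq_aeval hm hxy
  obtain ⟨q, rfl⟩ : ∃ q : (K⟮x⟯)[X], Polynomial.aeval y q = z := by
    have hz : z ∈ (IntermediateField.adjoin K⟮x⟯ {y}).toSubalgebra := by
      rw [adjoin_eq_top_of_adjoin_pair hF]; trivial
    rwa [IntermediateField.adjoin_simple_toSubalgebra_of_isAlgebraic hint.isAlgebraic,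
      Algebra.adjoin_singleton_eq_range_aeval] at hz
  set p : (K⟮x⟯)[X] := Polynomial.X ^ m -
    Polynomial.C (Polynomial.aeval (IntermediateField.AdjoinSimple.gen K x) f) with hp
  have hmonic : p.Monic := Polynomial.monic_X_pow_sub_C _ hm.ne'
  have hroot : Polynomial.aeval y p = 0 := by
    rw [hp, map_sub, map_pow, Polynomial.aeval_X, Polynomial.aeval_C, hxy, sub_eq_zero]
    exact (coe_aeval_gen f).symm
  have hdeg : (q %ₘ p).natDegree < m := by
    have := Polynomial.natDegree_modByMonic_lt q hmonic (by
      intro h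
      have := congrArg Polynomial.natDegree h
      rw [hp, Polynomial.natDegree_X_pow_sub_C, Polynomial.natDegree_one] at this
      omega)
    rwa [hp, Polynomial.natDegree_X_pow_sub_C, ← hp] at this
  refine ⟨fun j => (q %ₘ p).coeff j, ?_⟩
  rw [← Polynomial.aeval_modByMonic_eq_self_of_root hroot,
    Polynomial.aeval_eq_sum_range' hdeg, Finset.sum_range]
  rfl

end Kummer

end AlgFunctionField

namespace AlgFunctionField

/-! ### The integral closure of `K[x]` is `K[x, y]` -/

section IntegralElements

open scoped IntermediateField.algebraAdjoinAdjoin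

variable {K F : Type*} [Field K] [Field F] [Algebra K F] {P : Place K F} {x y : F} {m : ℕ}
  {f : K[X]}

lemma exists_place_over_irreducible [FiniteDimensional K⟮x⟯ F] [Algebra.IsSeparable K⟮x⟯ F]
    (hx : Transcendental K x) {π : K[X]} (hπ : Irreducible π) :
    ∃ P : Place K F, P.v x ≤ 1 ∧ P.v (Polynomial.aeval x π) < 1 := by
  have he := Polynomial.algEquivOfTranscendental_apply K x hx π
  have hcoe : ((Polynomial.algEquivOfTranscendental K x hx π : Algebra.adjoin K {x}) : F) =
      Polynomial.aeval x π := by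
    rw [he, ← Subalgebra.coe_val, ← Polynomial.aeval_algHom_apply]
    rfl
  rw [← hcoe]
  refine exists_place_lt_one x hx _ ?_ ?_
  · exact (EmbeddingLike.map_ne_zero_iff).2 hπ.ne_zero
  · exact fun h => hπ.not_isUnit ((isUnit_map_iff (Polynomial.algEquivOfTranscendental K x hx) π).1 h)

lemma Place.v_le_one_of_isIntegral (hxP : P.v x ≤ 1) {z : F}
    (hz : IsIntegral (Algebra.adjoin K {x}) z) : P.v z ≤ 1 := by
  obtain ⟨p, hp, hpz⟩ := hz
  have hle : ∀ a : Algebra.adjoin K {x}, (a : F) ∈ P.v.integer := fun a => by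
    obtain ⟨g, hg⟩ := (Algebra.adjoin_singleton_eq_range_aeval K x).le a.2
    exact (P.v.mem_integer_iff _).2 (hg ▸ P.v_aeval_le_one hxP g)
  let φ : Algebra.adjoin K {x} →+* P.v.integer :=
    (algebraMap (Algebra.adjoin K {x}) F).codRestrict P.v.integer hle
  have : IsIntegral P.v.integer z := ⟨p.map φ, hp.map φ, by
    rw [Polynomial.eval₂_map]; exact hpz⟩
  exact (P.v.mem_integer_iff _).1 ((Valuation.integer.integers P.v).mem_of_integral this)

/-- One separating place already gives linear independence, so irreducibility of `Y ^ m - f` is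
never needed. -/
lemma exists_powers_basis (hP : P.Separates x y m) (hy : y ≠ 0)
    (hspan : ∀ z : F, ∃ h : Fin m → K⟮x⟯, z = ∑ j, (h j : F) * y ^ (j : ℕ)) :
    ∃ b : Module.Basis (Fin m) K⟮x⟯ F, ∀ i, b i = y ^ (i : ℕ) := by
  have hli : LinearIndependent K⟮x⟯ fun i : Fin m => y ^ (i : ℕ) :=
    Fintype.linearIndependent_iff.2 fun h hs j => hP.eq_zero hy hs j
  refine ⟨Module.Basis.mk hli fun z _ => ?_, fun i => Module.Basis.mk_apply _ _ _⟩
  obtain ⟨h, rfl⟩ := hspan z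
  exact Submodule.sum_mem _ fun j _ =>
    Submodule.smul_mem _ (h j) (Submodule.subset_span ⟨j, rfl⟩)

/-- The trace of `y ^ k` for `y` a radical of degree `m` and `k` not divisible by
`m` vanishes. -/
lemma trace_pow_eq_zero {L M : Type*} [Field L] [Field M] [Algebra L M] {y : M} {m : ℕ} {c : L}
    (b : Module.Basis (Fin m) L M) (hb : ∀ i, b i = y ^ (i : ℕ)) (hy : y ^ m = algebraMap L M c)
    {k : ℕ} (hk : ¬ m ∣ k) : Algebra.trace L M (y ^ k) = 0 := by
  classical
  rw [Algebra.trace_eq_matrix_trace b]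
  -- Multiplication by `y ^ k` shifts the basis cyclically by `k`, up to scalars, so its matrix has
  -- zero diagonal.
  refine Finset.sum_eq_zero fun i _ => ?_
  rw [Matrix.diag_apply, Algebra.leftMulMatrix_eq_repr_mul]
  have hm : 0 < m := lt_of_le_of_lt (Nat.zero_le _) i.2
  have hs : (k + i) % m < m := Nat.mod_lt _ hm
  have : y ^ k * b i = c ^ ((k + i) / m) • b ⟨(k + i) % m, hs⟩ := by
    rw [hb, hb, Algebra.smul_def, map_pow, ← hy, ← pow_mul, ← pow_add, ← pow_add,
      Nat.div_add_mod]
  rw [this, map_smul, Finsupp.smul_apply, b.repr_self, Finsupp.single_apply, if_neg, smul_zero]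
  intro h
  have h1 : (k + i) % m = i := congrArg Fin.val h
  have h2 : (k + i) ≡ 0 + i [MOD m] := by
    rw [Nat.ModEq, h1, Nat.zero_add, Nat.mod_eq_of_lt i.2]
  exact hk ((Nat.modEq_zero_iff_dvd).1 (Nat.ModEq.add_right_cancel' _ h2))

/-- The trace against `y ^ (m - i)` isolates the `i`-th coefficient: `0 < j + m - i < 2 m`, so this
exponent is divisible by `m` only for `j = i`. -/
lemma trace_sum_mul_pow {L M : Type*} [Field L] [Field M] [Algebra L M] {y : M} {m : ℕ} {c : L}
    (b : Module.Basis (Fin m) L M) (hb : ∀ i, b i = y ^ (i : ℕ)) (hy : y ^ m = algebraMap L M c)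
    (h : Fin m → L) (i : Fin m) :
    Algebra.trace L M ((∑ j, algebraMap L M (h j) * y ^ (j : ℕ)) * y ^ (m - i : ℕ)) =
      m * (c * h i) := by
  have hi := i.2
  rw [Finset.sum_mul, map_sum, Finset.sum_eq_single i]
  · rw [mul_assoc, ← pow_add, Nat.add_sub_cancel' i.2.le, hy, ← map_mul, Algebra.trace_algebraMap,
      Module.finrank_eq_card_basis b, Fintype.card_fin, nsmul_eq_mul, mul_comm (h i)]
  · intro j _ hji
    have hj := j.2
    rw [mul_assoc, ← pow_add, ← Algebra.smul_def, map_smul, trace_pow_eq_zero b hb hy, smul_zero]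
    rintro ⟨k, hk⟩
    have hk1 : k = 1 := by
      rcases Nat.lt_trichotomy k 1 with h1 | h1 | h1
      · interval_cases k; omega
      · exact h1
      · have : m * 2 ≤ m * k := Nat.mul_le_mul_left _ h1
        omega
    subst hk1
    exact hji (Fin.ext (by omega))
  · intro h; exact absurd (Finset.mem_univ i) h

lemma dvd_of_forall_irreducible_dvd {f g : K[X]} (hf : Squarefree f)
    (h : ∀ π, Irreducible π → π ∣ f → π ∣ g) : f ∣ g := by
  classical
  obtain ⟨e, he⟩ := EuclideanDomain.gcd_dvd_left f g
  have hf0 : f ≠ 0 := hf.ne_zero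
  by_cases hu : IsUnit e
  · obtain ⟨u, rfl⟩ := hu
    refine dvd_trans ?_ (EuclideanDomain.gcd_dvd_right f g)
    conv_lhs => rw [he]
    exact (Units.dvd_mul_right.1 dvd_rfl)
  · have he0 : e ≠ 0 := by
      rintro rfl
      exact hf0 (by rw [he, mul_zero])
    obtain ⟨π, hπ, hπe⟩ := WfDvdMonoid.exists_irreducible_factor hu he0
    have hπf : π ∣ f := hπe.trans ⟨_, by rw [mul_comm]; exact he⟩
    have hπd := EuclideanDomain.dvd_gcd hπf (h π hπ hπf)
    exact absurd (hf π (by conv_rhs => rw [he]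
                           exact mul_dvd_mul hπd hπe)) hπ.not_isUnit

/-- The integral closure of `K[x]` in `K(x, y)`, `y ^ m = f(x)`, is `K[x, y]`. -/
lemma exists_eq_sum_of_isIntegral [FiniteDimensional K⟮x⟯ F] [Algebra.IsSeparable K⟮x⟯ F]
    (hx : Transcendental K x) (hm : 0 < m) (hmK : (m : K) ≠ 0) (hf : Squarefree f)
    (hxy : y ^ m = Polynomial.aeval x f) (hy : y ≠ 0)
    (hspan : ∀ z : F, ∃ h : Fin m → K⟮x⟯, z = ∑ j, (h j : F) * y ^ (j : ℕ))
    (hP : P.Separates x y m) {z : F} (hz : IsIntegral (Algebra.adjoin K {x}) z) :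
    ∃ g : Fin m → K[X], z = ∑ j, Polynomial.aeval x (g j) * y ^ (j : ℕ) := by
  have := isDedekindDomain_adjoin x hx
  obtain ⟨b, hb⟩ := exists_powers_basis hP hy hspan
  obtain ⟨h, hh⟩ := hspan z
  set c : K⟮x⟯ := Polynomial.aeval (IntermediateField.AdjoinSimple.gen K x) f with hc
  have hyc : y ^ m = algebraMap K⟮x⟯ F c := by rw [hxy]; exact (coe_aeval_gen f).symm
  have hxint : ∀ g : K[X], IsIntegral (Algebra.adjoin K {x}) (Polynomial.aeval x g) := fun g =>
    isIntegral_algebraMap (A := F) (x := (⟨Polynomial.aeval x g, by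
      rw [Algebra.adjoin_singleton_eq_range_aeval]; exact ⟨g, rfl⟩⟩ : Algebra.adjoin K {x}))
  have hyint : IsIntegral (Algebra.adjoin K {x}) y := by
    refine IsIntegral.of_pow hm ?_
    rw [hxy]
    exact hxint f
  -- The trace of `z y ^ (m - i)` is `m f h_i`; it is integral over the integrally closed `K[x]`,
  -- and `m` is invertible.
  have hG : ∀ i, ∃ G : K[X], Polynomial.aeval x f * (h i : F) = Polynomial.aeval x G := by
    intro i
    have htr := Algebra.isIntegral_trace (L := K⟮x⟯) (hz.mul (hyint.pow (m - i)))
    rw [hh] at htr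
    rw [show (∑ j, (h j : F) * y ^ (j : ℕ)) = ∑ j, algebraMap K⟮x⟯ F (h j) * y ^ (j : ℕ) from rfl,
      trace_sum_mul_pow b hb hyc h i] at htr
    obtain ⟨a, ha⟩ := IsIntegrallyClosed.isIntegral_iff.1 htr
    obtain ⟨G, hG⟩ := (Algebra.adjoin_singleton_eq_range_aeval K x).le a.2
    have ha' : (a : F) = m * (Polynomial.aeval x f * (h i : F)) := by
      have := congrArg (fun t : K⟮x⟯ => (t : F)) ha
      simpa [hc, coe_aeval_gen] using this
    refine ⟨Polynomial.C (m : K)⁻¹ * G, ?_⟩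
    have hmF : (m : F) ≠ 0 := by simpa using (map_ne_zero (algebraMap K F)).2 hmK
    have hG' : Polynomial.aeval x G = (a : F) := hG
    rw [map_mul, Polynomial.aeval_C, hG', ha', map_inv₀, map_natCast, inv_mul_cancel_left₀ hmF]
  choose G hG using hG
  have hfz : Polynomial.aeval x f * z =
      ∑ j, ((Polynomial.aeval (IntermediateField.AdjoinSimple.gen K x) (G j) : K⟮x⟯) : F) *
        y ^ (j : ℕ) := by
    rw [hh, Finset.mul_sum]
    refine Finset.sum_congr rfl fun j _ => ?_
    rw [coe_aeval_gen, ← hG, mul_assoc]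
  have hdvd : ∀ i, f ∣ G i := by
    refine fun i => dvd_of_forall_irreducible_dvd hf fun π hπ hπf => ?_
    obtain ⟨f', hf'⟩ := hπf
    have hπf' : ¬ π ∣ f' := fun hd => hπ.not_isUnit (hf π (hf' ▸ mul_dvd_mul_left π hd))
    obtain ⟨Q, hQx, hQπ⟩ := exists_place_over_irreducible hx hπ
    obtain ⟨hQy, hQv, hQs⟩ := Place.values_of_factor hQx hπ hQπ hx hf' hπf' hm hxy hspan
    -- At `Q` the term `G_i y ^ i` has order `i < m` if `π ∤ G_i`, while `f z` has order at least
    -- `m`, and no term can have smaller order than the sum.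
    by_contra hnd
    have hle := hQs.le_sum hy (fun j =>
      Polynomial.aeval (IntermediateField.AdjoinSimple.gen K x) (G j)) i
    rw [← hfz, coe_aeval_gen, map_mul, Q.v_aeval_eq_one hQx hπ hQπ hnd, one_mul, map_pow, hQy,
      ← hxy, map_mul, map_pow, hQy] at hle
    have h2 := hle.trans (mul_le_of_le_one_right' (Q.v_le_one_of_isIntegral hQx hz))
    rw [← WithZero.exp_nsmul, ← WithZero.exp_nsmul, WithZero.exp_le_exp] at h2
    have := i.2
    simp at h2
    omega
  choose g hg using hdvd
  refine ⟨g, mul_left_cancel₀ (a := Polynomial.aeval x f) ?_ ?_⟩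
  · exact hxy ▸ pow_ne_zero _ hy
  · rw [hfz, Finset.mul_sum]
    refine Finset.sum_congr rfl fun j _ => ?_
    rw [coe_aeval_gen, hg, map_mul, mul_assoc]

end IntegralElements

end AlgFunctionField

namespace AlgFunctionField

/-! ### Totally ramified rational places lie over roots of `f` -/

section TotallyRamified

variable {K F : Type*} [Field K] [Field F] [Algebra K F] {P : Place K F} {x y : F} {m : ℕ}
  {f : K[X]}

/-- First-order expansion of an `m`-th power at a unit `y`. -/
lemma Place.v_pow_sub_pow (hm : P.v (m : F) = 1) {y g : F} (hy : P.v y = 1)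
    (hg : P.v (y - g) < 1) : P.v (y ^ m - g ^ m) = P.v (y - g) := by
  have hgy : P.v (g - y) < 1 := by rwa [P.v.map_sub_swap]
  let Y : P.v.integer := ⟨y, (P.v.mem_integer_iff y).2 hy.le⟩
  let D : P.v.integer := ⟨g - y, (P.v.mem_integer_iff _).2 hgy.le⟩
  obtain ⟨k, hk⟩ := Polynomial.powAddExpansion Y D m
  have hk' : (y + (g - y)) ^ m = y ^ m + m * y ^ (m - 1) * (g - y) + (k : F) * (g - y) ^ 2 := by
    have := congrArg (fun t : P.v.integer => (t : F)) hk
    push_cast at this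
    exact this
  have hkv : P.v (k : F) ≤ 1 := (P.v.mem_integer_iff _).1 k.2
  have heq : g ^ m - y ^ m = (m * y ^ (m - 1) + (k : F) * (g - y)) * (g - y) := by
    rw [add_sub_cancel] at hk'
    rw [hk']
    ring
  rw [P.v.map_sub_swap, heq, map_mul, P.v.map_sub_swap y g, P.v.map_add_eq_of_lt_left, map_mul,
    map_pow, hm, hy, one_pow, one_mul, one_mul]
  rw [map_mul, map_mul, map_pow, hm, hy, one_pow, one_mul]
  exact mul_lt_one_of_nonneg_of_lt_one_right hkv zero_le hgy

/-- Newton iteration for `Y ^ m = c` inside `K(x)`; rationality keeps every correction there. -/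
lemma Place.exists_approx (hm : P.v (m : F) = 1) (hP : P.IsRational) (hy : P.v y = 1)
    {c : K⟮x⟯} (hyc : y ^ m = (c : F)) (n : ℕ) :
    ∃ g : K⟮x⟯, P.v (y - (g : F)) ≤ WithZero.exp (-((n : ℤ) + 1)) := by
  induction n with
  | zero =>
    obtain ⟨d, hd⟩ := hP y hy.le
    refine ⟨algebraMap K K⟮x⟯ d, ?_⟩
    have := P.v_le_exp_sub_one (z := y - algebraMap K F d) (k := 0) (by simpa using hd)
    simpa using this
  | succ n ih =>
    obtain ⟨g, hg⟩ := ih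
    by_cases hyg : y - (g : F) = 0
    · exact ⟨g, by simp [hyg]⟩
    have hlt : P.v (y - (g : F)) < 1 := by
      refine hg.trans_lt ?_
      rw [← WithZero.exp_zero, WithZero.exp_lt_exp]
      omega
    have hv := P.v_pow_sub_pow hm hy hlt
    have hve0 : P.v (y - (g : F)) ≠ 0 := (P.v.ne_zero_iff).2 hyg
    set e : F := y ^ m - (g : F) ^ m with he
    have he0 : e ≠ 0 := (P.v.ne_zero_iff).1 (by rwa [hv])
    have hunit : P.v ((y - (g : F)) / e) ≤ 1 := by
      rw [map_div₀, hv, div_self hve0]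
    obtain ⟨a, ha⟩ := hP _ hunit
    -- The constant `a` is the residue of `(y - g) / (y ^ m - g ^ m)` and plays the role of the
    -- inverse derivative in Newton's step.
    refine ⟨g + algebraMap K K⟮x⟯ a * (c - g ^ m), ?_⟩
    have hcoe : y - ((g + algebraMap K K⟮x⟯ a * (c - g ^ m) : K⟮x⟯) : F) =
        ((y - (g : F)) / e - algebraMap K F a) * e := by
      have : ((g + algebraMap K K⟮x⟯ a * (c - g ^ m) : K⟮x⟯) : F) =
          (g : F) + algebraMap K F a * e := by
        rw [he, hyc]
        simp
      rw [this, sub_mul, div_mul_cancel₀ _ he0]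
      ring
    rw [hcoe]
    have h2 : P.v (((y - (g : F)) / e - algebraMap K F a) * e) <
        WithZero.exp (-((n : ℤ) + 1)) := by
      rw [map_mul, hv]
      calc _ < 1 * P.v (y - (g : F)) := by
            gcongr
            exact zero_lt_iff.2 hve0
        _ ≤ _ := by rwa [one_mul]
    refine (P.v_le_exp_sub_one h2).trans_eq ?_
    congr 1

/-- If `y` is a limit of elements of `K(x)` at `P` then `K(x)` has full value group at `P`. -/
lemma Place.exists_v_eq_of_approx (hy : P.v y ≤ 1)
    (hspan : ∀ z : F, ∃ h : Fin m → K⟮x⟯, z = ∑ j, (h j : F) * y ^ (j : ℕ))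
    (happ : ∀ n : ℕ, ∃ g : K⟮x⟯, P.v (y - (g : F)) ≤ WithZero.exp (-((n : ℤ) + 1)))
    {z : F} (hz : z ≠ 0) : ∃ g : K⟮x⟯, P.v (g : F) = P.v z := by
  obtain ⟨h, hh⟩ := hspan z
  obtain ⟨k, hk⟩ := P.exists_v_eq_exp hz
  have hbound : ∃ b : ℕ, ∀ j, P.v (h j : F) ≤ WithZero.exp (b : ℤ) := by
    refine ⟨∑ j, (WithZero.log (P.v (h j : F))).natAbs, fun j => ?_⟩
    by_cases hj : (h j : F) = 0
    · simp [hj]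
    · rw [← WithZero.exp_log ((P.v.ne_zero_iff).2 hj), WithZero.exp_le_exp]
      have := Finset.single_le_sum (f := fun j => (WithZero.log (P.v (h j : F))).natAbs)
        (fun _ _ => Nat.zero_le _) (Finset.mem_univ j)
      omega
  obtain ⟨b, hb⟩ := hbound
  -- With coefficients bounded by `exp b`, this precision makes the error of replacing `y` by `g`
  -- smaller than `P.v z = exp k`.
  obtain ⟨g, hg⟩ := happ (b + k.natAbs)
  have hg1 : P.v (g : F) ≤ 1 := by
    have : (g : F) = y - (y - g) := by ring
    rw [this]
    refine P.v.map_sub_le hy (hg.trans ?_)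
    rw [← WithZero.exp_zero, WithZero.exp_le_exp]
    omega
  refine ⟨∑ j, h j * g ^ (j : ℕ), ?_⟩
  have hcoe : ((∑ j, h j * g ^ (j : ℕ) : K⟮x⟯) : F) = ∑ j, (h j : F) * (g : F) ^ (j : ℕ) := by
    simp
  have hlt : P.v (z - ((∑ j, h j * g ^ (j : ℕ) : K⟮x⟯) : F)) < P.v z := by
    rw [hcoe, hh, ← Finset.sum_sub_distrib, ← hh]
    refine P.v.map_sum_lt ((P.v.ne_zero_iff).2 hz) fun j _ => ?_
    rw [← mul_sub, ← (Commute.all y (g : F)).geom_sum₂_mul, map_mul, map_mul]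
    have hsum : P.v (∑ i ∈ Finset.range j, y ^ i * (g : F) ^ (j - 1 - i : ℕ)) ≤ 1 :=
      P.v.map_sum_le fun i _ => by
        rw [map_mul, map_pow, map_pow]
        exact mul_le_one' (pow_le_one' hy _) (pow_le_one' hg1 _)
    calc _ ≤ WithZero.exp (b : ℤ) * (1 * WithZero.exp (-(((b + k.natAbs : ℕ) : ℤ) + 1))) := by
          gcongr
          exact hb j
      _ < P.v z := by
          rw [one_mul, ← WithZero.exp_add, hk, WithZero.exp_lt_exp]
          have := neg_abs_le k
          push_cast
          linarith
  have := P.v.map_sub_eq_of_lt_left hlt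
  rwa [sub_sub_cancel] at this

/-- A rational place totally ramified over `K(x)` that is not a pole of `x` lies over a root of
`f`. -/
lemma Place.exists_root_of_totallyRamified [FiniteDimensional K⟮x⟯ F] (hm : 2 ≤ m)
    (hmK : (m : K) ≠ 0)
    (hrank : Module.finrank K⟮x⟯ F = m) (hxy : y ^ m = Polynomial.aeval x f)
    (hspan : ∀ z : F, ∃ h : Fin m → K⟮x⟯, z = ∑ j, (h j : F) * y ^ (j : ℕ))
    (hP : P.IsRational) (hram : P.IsTotallyRamified K⟮x⟯) (hxP : ¬ P.IsPole x) :
    P.v x ≤ 1 ∧ ∃ c : K, f.IsRoot c ∧ P.v (Polynomial.aeval x (Polynomial.X - Polynomial.C c)) < 1 := by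
  have hx1 : P.v x ≤ 1 := not_lt.1 hxP
  obtain ⟨c, hc⟩ := hP x hx1
  have hc' : P.v (Polynomial.aeval x (Polynomial.X - Polynomial.C c)) < 1 := by simpa using hc
  refine ⟨hx1, c, ?_, hc'⟩
  by_contra hroot
  have hfx := P.v_aeval_eq_one hx1 (Polynomial.irreducible_X_sub_C c) hc'
    (fun h => hroot (Polynomial.dvd_iff_isRoot.1 h))
  have hy : P.v y = 1 := by
    rw [← hxy, map_pow] at hfx
    exact (pow_eq_one_iff_of_nonneg zero_le (by omega)).1 hfx
  have hmv : P.v (m : F) = 1 := by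
    rw [← map_natCast (algebraMap K F)]
    exact P.trivial_on_constants _ hmK
  have happ := P.exists_approx hmv hP hy (x := x) (c := Polynomial.aeval
    (IntermediateField.AdjoinSimple.gen K x) f) (by rw [hxy, coe_aeval_gen])
  have h1 : P.ramificationIdx K⟮x⟯ = 1 := by
    rw [Place.ramificationIdx, Subgroup.index_eq_one, eq_top_iff]
    intro u _
    obtain ⟨z, hz⟩ := P.surj u
    have hz0 : z ≠ 0 := (P.v.ne_zero_iff).1 (hz ▸ u.ne_zero)
    obtain ⟨g, hg⟩ := P.exists_v_eq_of_approx hy.le hspan happ hz0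
    have hg0 : g ≠ 0 := by
      rintro rfl
      exact u.ne_zero (by rw [← hz, ← hg]; simp)
    exact ⟨Units.mk0 g hg0, Units.ext (hg.trans hz)⟩
  rw [Place.IsTotallyRamified, h1, hrank] at hram
  omega

end TotallyRamified

end AlgFunctionField

namespace AlgFunctionField

/-! ### A criterion for pure gaps at two places -/

section PureGaps

variable {K F : Type*} [Field K] [Field F] [Algebra K F]

lemma isPureGap_pair {P Q : Place K F} (hPQ : P ≠ Q) {a b : ℕ}
    (h : ∀ z : F, P.v z ≤ WithZero.exp (a : ℤ) → Q.v z ≤ WithZero.exp (b : ℤ) →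
      (∀ R : Place K F, R ≠ P → R ≠ Q → R.v z ≤ 1) →
      P.v z ≠ WithZero.exp (a : ℤ) ∧ Q.v z ≠ WithZero.exp (b : ℤ)) :
    IsPureGap ![P, Q] ![a, b] := by
  have hD : divisorOf ![P, Q] ![a, b] = Finsupp.single P (a : ℤ) + Finsupp.single Q (b : ℤ) := by
    simp [divisorOf]
  have key : ∀ z ∈ riemannRochSpace (divisorOf ![P, Q] ![a, b]), ∀ j : Fin 2,
      (![P, Q] j).v z < WithZero.exp (divisorOf ![P, Q] ![a, b] (![P, Q] j)) := by
    intro z hz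
    rw [hD] at hz ⊢
    have hz' : ∀ R : Place K F, R.v z ≤
      WithZero.exp ((Finsupp.single P (a : ℤ) + Finsupp.single Q (b : ℤ)) R) := hz
    have hzP := hz' P
    have hzQ := hz' Q
    simp only [Finsupp.add_apply, Finsupp.single_eq_same, Finsupp.single_eq_of_ne hPQ,
      Finsupp.single_eq_of_ne hPQ.symm, add_zero, zero_add] at hzP hzQ
    obtain ⟨hP, hQ⟩ := h z hzP hzQ fun R hRP hRQ => by
      have := hz' R
      rwa [Finsupp.add_apply, Finsupp.single_eq_of_ne hRP, Finsupp.single_eq_of_ne hRQ, add_zero,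
        WithZero.exp_zero] at this
    rw [Fin.forall_fin_two]
    constructor
    · simpa [Finsupp.single_eq_of_ne hPQ] using lt_of_le_of_ne hzP hP
    · simpa [Finsupp.single_eq_of_ne hPQ.symm] using lt_of_le_of_ne hzQ hQ
  classical
  intro j
  -- The two spaces coincide, so finiteness of their dimensions plays no role.
  suffices hs : riemannRochSpace (divisorOf ![P, Q] ![a, b]) =
      riemannRochSpace (divisorOf ![P, Q] ![a, b] - Finsupp.single (![P, Q] j) 1) by
    rw [ell, ell, ← hs]
  refine le_antisymm (fun z hz R => ?_) (fun z hz R => (hz R).trans ?_)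
  · rw [Finsupp.sub_apply]
    by_cases hR : R = ![P, Q] j
    · rw [hR, Finsupp.single_eq_same]
      exact Place.v_le_exp_sub_one _ (key z hz j)
    · rw [Finsupp.single_eq_of_ne hR, sub_zero]
      exact hz R
  · rw [WithZero.exp_le_exp, Finsupp.sub_apply, sub_le_self_iff, Finsupp.single_apply]
    split_ifs <;> norm_num

end PureGaps

/-- `F = K(x, y)` with `x` transcendental and `y ^ m = f(x)`, where `m ≥ 2` is invertible in `K` and
prime to the degree of the squarefree polynomial `f`. -/
structure IsKummerCurve {K F : Type*} [Field K] [Field F] [Algebra K F] (x y : F) (m : ℕ)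
    (f : K[X]) : Prop where
  transcendental : Transcendental K x
  two_le : 2 ≤ m
  cast_ne_zero : (m : K) ≠ 0
  squarefree : Squarefree f
  coprime : Nat.Coprime m f.natDegree
  pow_eq : y ^ m = Polynomial.aeval x f
  adjoin_eq_top : IntermediateField.adjoin K {x, y} = ⊤

/-- The values at `P` of a sum of terms `g(x) y ^ j` over distinct residues `j`. -/
lemma Place.Separates.polynomial_sum {K F : Type*} [Field K] [Field F] [Algebra K F]
    {P : Place K F} {x y : F} {m : ℕ} (hP : P.Separates x y m) (hy : y ≠ 0) (hm : 0 < m)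
    {e : ℤ} (hye : P.v y = WithZero.exp e) {d : K[X] → ℤ}
    (hd : ∀ g : K[X], g ≠ 0 → P.v (Polynomial.aeval x g) = WithZero.exp (d g))
    (g : Fin m → K[X]) :
    (∀ N : ℤ, P.v (∑ j, Polynomial.aeval x (g j) * y ^ (j : ℕ)) ≤ WithZero.exp N →
      ∀ j, g j ≠ 0 → d (g j) + j * e ≤ N) ∧
    (∀ N : ℤ, P.v (∑ j, Polynomial.aeval x (g j) * y ^ (j : ℕ)) = WithZero.exp N →
      ∃ j, g j ≠ 0 ∧ d (g j) + j * e = N) := by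
  have hterm : ∀ j, g j ≠ 0 → P.v (Polynomial.aeval x (g j) * y ^ (j : ℕ)) =
      WithZero.exp (d (g j) + j * e) := fun j hj => by
    rw [map_mul, map_pow, hd _ hj, hye, ← WithZero.exp_nsmul, ← WithZero.exp_add, nsmul_eq_mul]
  constructor
  · intro N hN j hj
    have := hP.le_sum hy
      (fun j => Polynomial.aeval (IntermediateField.AdjoinSimple.gen K x) (g j)) j
    simp only [coe_aeval_gen] at this
    rw [← WithZero.exp_le_exp, ← hterm j hj]
    exact this.trans hN
  · intro N hN
    obtain ⟨j, hj, -⟩ := hP.sum hy hm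
      (fun j => Polynomial.aeval (IntermediateField.AdjoinSimple.gen K x) (g j))
    simp only [coe_aeval_gen] at hj
    have hj0 : g j ≠ 0 := by
      intro h0
      rw [h0, hN] at hj
      simp at hj
    exact ⟨j, hj0, by rwa [hN, hterm j hj0, WithZero.exp_inj, eq_comm] at hj⟩

lemma multiplicity_le_natDegree {K : Type*} [Field K] (c : K) {g : K[X]} (hg : g ≠ 0) :
    multiplicity (Polynomial.X - Polynomial.C c) g ≤ g.natDegree := by
  have := Polynomial.natDegree_le_of_dvd
    (pow_multiplicity_dvd (Polynomial.X - Polynomial.C c) g) hg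
  rwa [Polynomial.natDegree_pow, Polynomial.natDegree_X_sub_C, mul_one] at this

/-! ### Places of the curve and expansions of functions with prescribed poles -/

namespace IsKummerCurve

variable {K F : Type*} [Field K] [Field F] [Algebra K F] {x y : F} {m : ℕ} {f : K[X]}

lemma pos (hC : IsKummerCurve x y m f) : 0 < m := by have := hC.two_le; omega

lemma ne_zero (hC : IsKummerCurve x y m f) : y ≠ 0 := by
  rintro rfl
  have h := hC.pow_eq
  rw [zero_pow hC.pos.ne'] at h
  exact hC.squarefree.ne_zero (transcendental_iff.1 hC.transcendental f h.symm)

lemma finiteDimensional (hC : IsKummerCurve x y m f) : FiniteDimensional K⟮x⟯ F :=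
  finiteDimensional_of_pow_eq hC.pos hC.pow_eq hC.adjoin_eq_top

lemma isSeparable (hC : IsKummerCurve x y m f) : Algebra.IsSeparable K⟮x⟯ F :=
  isSeparable_of_pow_eq hC.cast_ne_zero hC.squarefree.ne_zero hC.transcendental hC.pow_eq
    hC.adjoin_eq_top

lemma span (hC : IsKummerCurve x y m f) (z : F) :
    ∃ h : Fin m → K⟮x⟯, z = ∑ j, (h j : F) * y ^ (j : ℕ) :=
  exists_eq_sum_pow hC.pos hC.pow_eq hC.adjoin_eq_top z

lemma exists_pole (hC : IsKummerCurve x y m f) : ∃ P : Place K F, P.IsPole x :=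
  have := hC.finiteDimensional
  have := hC.isSeparable
  exists_isPole x hC.transcendental

lemma values_pole (hC : IsKummerCurve x y m f) {P : Place K F} (hP : P.IsPole x) :
    P.v y = WithZero.exp (f.natDegree : ℤ) ∧
      (∀ g : K[X], g ≠ 0 →
        P.v (Polynomial.aeval x g) = WithZero.exp ((m : ℤ) * g.natDegree)) ∧
      P.Separates x y m :=
  hP.values hC.pos hC.squarefree.ne_zero hC.coprime hC.pow_eq hC.span

/-- The place `P` lies over the root `c` of `f`. -/
def OverRoot (x : F) (f : K[X]) (P : Place K F) (c : K) : Prop :=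
  P.v x ≤ 1 ∧ f.IsRoot c ∧ P.v (Polynomial.aeval x (Polynomial.X - Polynomial.C c)) < 1

lemma values_overRoot (hC : IsKummerCurve x y m f) {P : Place K F} {c : K}
    (hP : OverRoot x f P c) :
    P.v y = WithZero.exp (-1 : ℤ) ∧
      (∀ g : K[X], g ≠ 0 → P.v (Polynomial.aeval x g) =
        WithZero.exp (-((m : ℤ) * multiplicity (Polynomial.X - Polynomial.C c) g))) ∧
      P.Separates x y m := by
  obtain ⟨hx, hroot, hc⟩ := hP
  obtain ⟨f', hf'⟩ := Polynomial.dvd_iff_isRoot.2 hroot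
  have hirr := Polynomial.irreducible_X_sub_C c
  exact Place.values_of_factor hx hirr hc hC.transcendental hf'
    (fun hd => hirr.not_isUnit (hC.squarefree _ (hf' ▸ mul_dvd_mul_left _ hd)))
    hC.pos hC.pow_eq hC.span

lemma pole_unique (hC : IsKummerCurve x y m f) {P Q : Place K F} (hP : P.IsPole x)
    (hQ : Q.IsPole x) : P = Q := by
  obtain ⟨hPy, hPg, hPs⟩ := hC.values_pole hP
  obtain ⟨hQy, hQg, hQs⟩ := hC.values_pole hQ
  exact hPs.eq_of_forall hQs hC.ne_zero hC.pos hC.span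
    (Place.v_eq_of_aeval fun g hg => (hPg g hg).trans (hQg g hg).symm) (hPy.trans hQy.symm)

lemma overRoot_unique (hC : IsKummerCurve x y m f) {P Q : Place K F} {c : K}
    (hP : OverRoot x f P c) (hQ : OverRoot x f Q c) : P = Q := by
  obtain ⟨hPy, hPg, hPs⟩ := hC.values_overRoot hP
  obtain ⟨hQy, hQg, hQs⟩ := hC.values_overRoot hQ
  exact hPs.eq_of_forall hQs hC.ne_zero hC.pos hC.span
    (Place.v_eq_of_aeval fun g hg => (hPg g hg).trans (hQg g hg).symm) (hPy.trans hQy.symm)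

lemma finrank_eq (hC : IsKummerCurve x y m f) : Module.finrank K⟮x⟯ F = m := by
  obtain ⟨P, hP⟩ := hC.exists_pole
  obtain ⟨b, -⟩ := exists_powers_basis (hC.values_pole hP).2.2 hC.ne_zero hC.span
  rw [Module.finrank_eq_card_basis b, Fintype.card_fin]

lemma exists_overRoot (hC : IsKummerCurve x y m f) {P : Place K F} (hP : P.IsRational)
    (hram : P.IsTotallyRamified K⟮x⟯) (hxP : ¬ P.IsPole x) : ∃ c, OverRoot x f P c := by
  have := hC.finiteDimensional
  obtain ⟨h1, c, h2, h3⟩ := Place.exists_root_of_totallyRamified hC.two_le hC.cast_ne_zero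
    hC.finrank_eq hC.pow_eq hC.span hP hram hxP
  exact ⟨c, h1, h2, h3⟩

lemma exists_eq_sum (hC : IsKummerCurve x y m f) {z : F}
    (hz : ∀ P : Place K F, P.v x ≤ 1 → P.v z ≤ 1) :
    ∃ g : Fin m → K[X], z = ∑ j, Polynomial.aeval x (g j) * y ^ (j : ℕ) := by
  have := hC.finiteDimensional
  have := hC.isSeparable
  obtain ⟨P, hP⟩ := hC.exists_pole
  exact exists_eq_sum_of_isIntegral hC.transcendental hC.pos hC.cast_ne_zero hC.squarefree
    hC.pow_eq hC.ne_zero hC.span (hC.values_pole hP).2.2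
    (isIntegral_of_forall_place_le_one x hC.transcendental z hz)

/-- A function with poles only at the pole of `x` and at a place over a root `c` of `f`,
multiplied by `x - c`, is a polynomial in `x` and `y`; its values in terms of the coefficients. -/
lemma exists_expansion_pole_root (hC : IsKummerCurve x y m f) {Pinf P₁ : Place K F} {c : K}
    (hinf : Pinf.IsPole x) (h₁ : OverRoot x f P₁ c) {a b : ℕ} (hb : b ≤ m) {z : F}
    (hza : Pinf.v z ≤ WithZero.exp (a : ℤ)) (hzb : P₁.v z ≤ WithZero.exp (b : ℤ))
    (hz : ∀ R : Place K F, R ≠ Pinf → R ≠ P₁ → R.v z ≤ 1) :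
    ∃ g : Fin m → K[X],
      (∀ j, g j ≠ 0 → (m : ℤ) * (g j).natDegree + j * f.natDegree ≤ a + m) ∧
      (∀ j, g j ≠ 0 →
        (m : ℤ) - b ≤ m * multiplicity (Polynomial.X - Polynomial.C c) (g j) + j) ∧
      (Pinf.v z = WithZero.exp (a : ℤ) →
        ∃ j, g j ≠ 0 ∧ (m : ℤ) * (g j).natDegree + j * f.natDegree = a + m) ∧
      (P₁.v z = WithZero.exp (b : ℤ) →
        ∃ j, g j ≠ 0 ∧
          (m : ℤ) * multiplicity (Polynomial.X - Polynomial.C c) (g j) + j = m - b) := by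
  obtain ⟨hiy, hig, his⟩ := hC.values_pole hinf
  obtain ⟨h1y, h1g, h1s⟩ := hC.values_overRoot h₁
  set l : K[X] := Polynomial.X - Polynomial.C c with hl
  have hl0 : l ≠ 0 := Polynomial.X_sub_C_ne_zero c
  have hil : Pinf.v (Polynomial.aeval x l) = WithZero.exp (m : ℤ) := by
    rw [hig l hl0, hl, Polynomial.natDegree_X_sub_C, Nat.cast_one, mul_one]
  have h1l : P₁.v (Polynomial.aeval x l) = WithZero.exp (-(m : ℤ)) := by
    have hmul : multiplicity l l = 1 := multiplicity_self
    rw [h1g l hl0, hmul, Nat.cast_one, mul_one]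
  have hvi : ∀ {k : ℤ}, Pinf.v z = WithZero.exp k →
      Pinf.v (Polynomial.aeval x l * z) = WithZero.exp (k + m) := fun h => by
    rw [map_mul, hil, h, ← WithZero.exp_add, add_comm]
  have hv1 : ∀ {k : ℤ}, P₁.v z = WithZero.exp k →
      P₁.v (Polynomial.aeval x l * z) = WithZero.exp (-(m - k)) := fun h => by
    rw [map_mul, h1l, h, ← WithZero.exp_add]
    congr 1
    ring
  have hvi' : Pinf.v (Polynomial.aeval x l * z) ≤ WithZero.exp ((a : ℤ) + m) := by
    rw [map_mul, hil, add_comm, WithZero.exp_add]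
    gcongr
  have hv1' : P₁.v (Polynomial.aeval x l * z) ≤ WithZero.exp (-((m : ℤ) - b)) := by
    rw [map_mul, h1l, neg_sub, sub_eq_add_neg, add_comm, WithZero.exp_add]
    gcongr
  -- The factor `x - c` vanishes to order `m ≥ b` at `P₁`, so it clears the only finite pole.
  obtain ⟨g, hg⟩ := hC.exists_eq_sum (z := Polynomial.aeval x l * z) fun R hR => by
    by_cases hR1 : R = P₁
    · subst hR1
      refine hv1'.trans ?_
      rw [← WithZero.exp_zero, WithZero.exp_le_exp]
      have : (b : ℤ) ≤ m := by exact_mod_cast hb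
      omega
    · have hRi : R ≠ Pinf := by
        rintro rfl
        exact absurd hinf (not_lt.2 hR)
      rw [map_mul]
      exact mul_le_one' (R.v_aeval_le_one hR l) (hz R hRi hR1)
  rw [hg] at hvi' hv1' hvi hv1
  obtain ⟨hi1, hi2⟩ := his.polynomial_sum hC.ne_zero hC.pos hiy hig g
  obtain ⟨h11, h12⟩ := h1s.polynomial_sum hC.ne_zero hC.pos h1y h1g g
  refine ⟨g, hi1 _ hvi', fun j hj => ?_, fun h => hi2 _ (hvi h), fun h => ?_⟩
  · have := h11 _ hv1' j hj
    linarith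
  · obtain ⟨j, hj, hj'⟩ := h12 _ (hv1 h)
    exact ⟨j, hj, by linarith⟩

/-- A function with poles of order `≤ a`, `≤ b` at places over roots `c₁`, `c₂` of `f` and no
others, multiplied by `(x - c₁) ^ s (x - c₂)`, is a polynomial in `x` and `y`; its values in terms
of the coefficients. -/
lemma exists_expansion_root_root (hC : IsKummerCurve x y m f) {P₁ P₂ : Place K F} {c₁ c₂ : K}
    (h₁ : OverRoot x f P₁ c₁) (h₂ : OverRoot x f P₂ c₂) (h12 : c₁ ≠ c₂) {a b s : ℕ}
    (ha : a ≤ m * s) (hb : b ≤ m) {z : F}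
    (hza : P₁.v z ≤ WithZero.exp (a : ℤ)) (hzb : P₂.v z ≤ WithZero.exp (b : ℤ))
    (hz : ∀ R : Place K F, R ≠ P₁ → R ≠ P₂ → R.v z ≤ 1) :
    ∃ g : Fin m → K[X],
      (∀ j, g j ≠ 0 → (m : ℤ) * (g j).natDegree + j * f.natDegree ≤ m * (s + 1)) ∧
      (∀ j, g j ≠ 0 →
        (m : ℤ) * s - a ≤ m * multiplicity (Polynomial.X - Polynomial.C c₁) (g j) + j) ∧
      (∀ j, g j ≠ 0 →
        (m : ℤ) - b ≤ m * multiplicity (Polynomial.X - Polynomial.C c₂) (g j) + j) ∧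
      (P₁.v z = WithZero.exp (a : ℤ) →
        ∃ j, g j ≠ 0 ∧
          (m : ℤ) * multiplicity (Polynomial.X - Polynomial.C c₁) (g j) + j = m * s - a) ∧
      (P₂.v z = WithZero.exp (b : ℤ) →
        ∃ j, g j ≠ 0 ∧
          (m : ℤ) * multiplicity (Polynomial.X - Polynomial.C c₂) (g j) + j = m - b) := by
  obtain ⟨Q, hQ⟩ := hC.exists_pole
  obtain ⟨hQy, hQg, hQs⟩ := hC.values_pole hQ
  obtain ⟨h1y, h1g, h1s⟩ := hC.values_overRoot h₁
  obtain ⟨h2y, h2g, h2s⟩ := hC.values_overRoot h₂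
  have hndvd : ∀ {c d : K}, c ≠ d →
      ¬ (Polynomial.X - Polynomial.C c) ∣ (Polynomial.X - Polynomial.C d) := fun hcd h => by
    rw [Polynomial.dvd_iff_isRoot, Polynomial.root_X_sub_C] at h
    exact hcd h.symm
  have hv12 := P₁.v_aeval_eq_one h₁.1 (Polynomial.irreducible_X_sub_C c₁) h₁.2.2 (hndvd h12)
  have hv21 := P₂.v_aeval_eq_one h₂.1 (Polynomial.irreducible_X_sub_C c₂) h₂.2.2 (hndvd h12.symm)
  set l₁ : K[X] := Polynomial.X - Polynomial.C c₁ with hl₁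
  set l₂ : K[X] := Polynomial.X - Polynomial.C c₂ with hl₂
  have hl₁0 : l₁ ≠ 0 := Polynomial.X_sub_C_ne_zero c₁
  have hl₂0 : l₂ ≠ 0 := Polynomial.X_sub_C_ne_zero c₂
  have hv1 : P₁.v (Polynomial.aeval x (l₁ ^ s * l₂)) = WithZero.exp (-((m : ℤ) * s)) := by
    have hmul : multiplicity l₁ l₁ = 1 := multiplicity_self
    rw [map_mul, map_mul, hv12, mul_one, map_pow, map_pow, h1g l₁ hl₁0, hmul,
      ← WithZero.exp_nsmul, nsmul_eq_mul]
    congr 1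
    push_cast
    ring
  have hv2 : P₂.v (Polynomial.aeval x (l₁ ^ s * l₂)) = WithZero.exp (-(m : ℤ)) := by
    have hmul : multiplicity l₂ l₂ = 1 := multiplicity_self
    rw [map_mul, map_mul, map_pow, map_pow, hv21, one_pow, one_mul, h2g l₂ hl₂0, hmul,
      Nat.cast_one, mul_one]
  have hvQ : Q.v (Polynomial.aeval x (l₁ ^ s * l₂)) = WithZero.exp ((m : ℤ) * (s + 1)) := by
    have hdeg : (l₁ ^ s * l₂).natDegree = s + 1 := by
      rw [Polynomial.natDegree_mul (pow_ne_zero _ hl₁0) hl₂0, Polynomial.natDegree_pow, hl₁, hl₂,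
        Polynomial.natDegree_X_sub_C, Polynomial.natDegree_X_sub_C, mul_one]
    rw [hQg _ (mul_ne_zero (pow_ne_zero _ hl₁0) hl₂0), hdeg, Nat.cast_add, Nat.cast_one]
  set w : F := Polynomial.aeval x (l₁ ^ s * l₂) with hw
  have hle1 : P₁.v (w * z) ≤ WithZero.exp (-((m : ℤ) * s - a)) := by
    rw [map_mul, hv1, neg_sub, sub_eq_add_neg, add_comm, WithZero.exp_add]
    gcongr
  have hle2 : P₂.v (w * z) ≤ WithZero.exp (-((m : ℤ) - b)) := by
    rw [map_mul, hv2, neg_sub, sub_eq_add_neg, add_comm, WithZero.exp_add]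
    gcongr
  have hleQ : Q.v (w * z) ≤ WithZero.exp ((m : ℤ) * (s + 1)) := by
    rw [map_mul, hvQ]
    refine mul_le_of_le_one_right' (hz Q ?_ ?_)
    · rintro rfl
      exact absurd hQ (not_lt.2 h₁.1)
    · rintro rfl
      exact absurd hQ (not_lt.2 h₂.1)
  have heq1 : ∀ {k : ℤ}, P₁.v z = WithZero.exp k →
      P₁.v (w * z) = WithZero.exp (-((m : ℤ) * s - k)) := fun h => by
    rw [map_mul, hv1, h, ← WithZero.exp_add]
    congr 1
    ring
  have heq2 : ∀ {k : ℤ}, P₂.v z = WithZero.exp k →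
      P₂.v (w * z) = WithZero.exp (-((m : ℤ) - k)) := fun h => by
    rw [map_mul, hv2, h, ← WithZero.exp_add]
    congr 1
    ring
  obtain ⟨g, hg⟩ := hC.exists_eq_sum (z := w * z) fun R hR => by
    by_cases hR1 : R = P₁
    · subst hR1
      refine hle1.trans ?_
      rw [← WithZero.exp_zero, WithZero.exp_le_exp]
      have : (a : ℤ) ≤ m * s := by exact_mod_cast ha
      omega
    by_cases hR2 : R = P₂
    · subst hR2
      refine hle2.trans ?_
      rw [← WithZero.exp_zero, WithZero.exp_le_exp]
      omega
    · rw [map_mul]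
      exact mul_le_one' (R.v_aeval_le_one hR _) (hz R hR1 hR2)
  rw [hg] at hle1 hle2 hleQ heq1 heq2
  obtain ⟨hQ1, -⟩ := hQs.polynomial_sum hC.ne_zero hC.pos hQy hQg g
  obtain ⟨h11, h12⟩ := h1s.polynomial_sum hC.ne_zero hC.pos h1y h1g g
  obtain ⟨h21, h22⟩ := h2s.polynomial_sum hC.ne_zero hC.pos h2y h2g g
  refine ⟨g, hQ1 _ hleQ, fun j hj => ?_, fun j hj => ?_, fun h => ?_, fun h => ?_⟩
  · have := h11 _ hle1 j hj
    linarith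
  · have := h21 _ hle2 j hj
    linarith
  · obtain ⟨j, hj, hj'⟩ := h12 _ (heq1 h)
    exact ⟨j, hj, by linarith⟩
  · obtain ⟨j, hj, hj'⟩ := h22 _ (heq2 h)
    exact ⟨j, hj, by linarith⟩

end IsKummerCurve

end AlgFunctionField

/-! ### Arithmetic of the three families -/

namespace AlgFunctionField.IsKummerCurve

variable {K F : Type*} [Field K] [Field F] [Algebra K F] {x y : F} {m : ℕ} {f : K[X]}

/-- When the bound at a root place is attained, this shows that the coefficient does not vanish at
the root, which determines `j`. -/
lemma eq_zero_of_mul_add_eq {m μ j : ℕ} {e : ℤ} (h : (m : ℤ) * μ + j = e) (he : e < m) :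
    μ = 0 := by
  by_contra h0
  have : (1 : ℤ) ≤ μ := by exact_mod_cast Nat.one_le_iff_ne_zero.2 h0
  nlinarith [Int.natCast_nonneg m]

lemma natDegree_pos_of_eq (hC : IsKummerCurve x y m f) {u : ℤ}
    (hu : (m : ℤ) = u * f.natDegree + 1) : 1 ≤ f.natDegree ∧ 1 ≤ u := by
  have hm := hC.two_le
  have h0 : f.natDegree ≠ 0 := by
    intro h
    rw [h] at hu
    push_cast at hu
    omega
  refine ⟨by omega, ?_⟩
  by_contra hu0
  have : (0 : ℤ) ≤ f.natDegree := by positivity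
  nlinarith

/-- Here `a + m = r (m - 2)`. Equality at the pole forces `j = m - 2` and a constant coefficient,
whose order at `P₁` is below `m - 1`. Equality at `P₁` forces `j = m - 1`, too large a pole at
infinity. -/
lemma isPureGap_pole_root_one (hC : IsKummerCurve x y m f) {Pinf P₁ : Place K F} {c : K}
    (hinf : Pinf.IsPole x) (h₁ : OverRoot x f P₁ c) (hne : P₁ ≠ Pinf) (hr : 1 ≤ f.natDegree)
    {a : ℕ} (ha : (a : ℤ) = ((f.natDegree : ℤ) - 1) * m - 2 * f.natDegree) :
    IsPureGap ![Pinf, P₁] ![a, 1] := by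
  have hm := hC.two_le
  refine isPureGap_pair hne.symm fun z hza hzb hz => ?_
  obtain ⟨g, hd, hμ, hinf', h1'⟩ :=
    hC.exists_expansion_pole_root hinf h₁ (by omega) hza hzb hz
  constructor
  · intro h
    obtain ⟨j, hj, hjd⟩ := hinf' h
    have hjm := j.2
    have hdvd : (m : ℤ) ∣ f.natDegree * (j + 2) := ⟨f.natDegree - (g j).natDegree, by
      rw [ha] at hjd
      linarith⟩
    have hdvd' : m ∣ (j : ℕ) + 2 := by
      exact_mod_cast (Nat.isCoprime_iff_coprime.2 hC.coprime).dvd_of_dvd_mul_left hdvd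
    have hj2 : (j : ℕ) + 2 = m := by
      obtain ⟨k, hk⟩ := hdvd'
      rcases Nat.lt_trichotomy k 1 with h1 | h1 | h1
      · interval_cases k; omega
      · rw [hk, h1, mul_one]
      · have : m * 2 ≤ m * k := Nat.mul_le_mul_left _ h1
        omega
    have hdeg : (g j).natDegree = 0 := by
      have hj2' : (j : ℤ) = m - 2 := by omega
      rw [ha, hj2'] at hjd
      have : (m : ℤ) * (g j).natDegree = 0 := by linarith
      have hm0 : (m : ℤ) ≠ 0 := by omega
      exact_mod_cast (mul_eq_zero.1 this).resolve_left hm0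
    have hmul : multiplicity (Polynomial.X - Polynomial.C c) (g j) = 0 :=
      Nat.le_zero.1 (hdeg ▸ multiplicity_le_natDegree c hj)
    have := hμ j hj
    rw [hmul] at this
    push_cast at this
    omega
  · intro h
    obtain ⟨j, hj, hjμ⟩ := h1' h
    have h0 := eq_zero_of_mul_add_eq hjμ (by push_cast; omega)
    rw [h0] at hjμ
    have := hd j hj
    have hj' : (j : ℤ) = m - 1 := by push_cast at hjμ; linarith
    rw [hj', ha] at this
    have h3 : (0 : ℤ) ≤ m * (g j).natDegree := by positivity
    have h4 : (1 : ℤ) ≤ f.natDegree := by exact_mod_cast hr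
    nlinarith

/-- Here `a + m = (r - 1) m - r`. Equality at the pole forces `j = m - 1` and then a negative
degree. Equality at `P₁` forces `j = m - b`, hence `m + r ≤ r b ≤ r (u + 1) = m - 1 + r`. -/
lemma isPureGap_pole_root (hC : IsKummerCurve x y m f) {Pinf P₁ : Place K F} {c : K}
    (hinf : Pinf.IsPole x) (h₁ : OverRoot x f P₁ c) (hne : P₁ ≠ Pinf) {u : ℤ}
    (hu : (m : ℤ) = u * f.natDegree + 1)
    {a b : ℕ} (ha : (a : ℤ) = ((f.natDegree : ℤ) - 2) * m - f.natDegree) (hb1 : 1 ≤ b)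
    (hbu : (b : ℤ) ≤ u + 1) : IsPureGap ![Pinf, P₁] ![a, b] := by
  have hm := hC.two_le
  obtain ⟨hr, hu1⟩ := hC.natDegree_pos_of_eq hu
  have hr' : (1 : ℤ) ≤ f.natDegree := by exact_mod_cast hr
  have hbm : b ≤ m := by
    have : (b : ℤ) ≤ m := by nlinarith
    exact_mod_cast this
  refine isPureGap_pair hne.symm fun z hza hzb hz => ?_
  obtain ⟨g, hd, hμ, hinf', h1'⟩ := hC.exists_expansion_pole_root hinf h₁ hbm hza hzb hz
  constructor
  · intro h
    obtain ⟨j, hj, hjd⟩ := hinf' h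
    have hjm := j.2
    have hdvd : (m : ℤ) ∣ f.natDegree * (j + 1) := ⟨f.natDegree - 1 - (g j).natDegree, by
      rw [ha] at hjd
      linarith⟩
    have hdvd' : m ∣ (j : ℕ) + 1 := by
      exact_mod_cast (Nat.isCoprime_iff_coprime.2 hC.coprime).dvd_of_dvd_mul_left hdvd
    have hle := Nat.le_of_dvd (Nat.succ_pos _) hdvd'
    have hj' : (j : ℤ) = m - 1 := by omega
    rw [hj', ha] at hjd
    have h3 : (0 : ℤ) ≤ m * (g j).natDegree := by positivity
    nlinarith
  · intro h
    obtain ⟨j, hj, hjμ⟩ := h1' h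
    have h0 := eq_zero_of_mul_add_eq hjμ (by omega)
    rw [h0] at hjμ
    have := hd j hj
    have hj' : (j : ℤ) = m - b := by push_cast at hjμ; linarith
    rw [hj', ha] at this
    have h3 : (0 : ℤ) ≤ m * (g j).natDegree := by positivity
    have h4 : (f.natDegree : ℤ) * b ≤ f.natDegree * (u + 1) := by gcongr
    nlinarith

lemma isPureGap_root_root (hC : IsKummerCurve x y m f) {P₁ P₂ : Place K F} {c₁ c₂ : K}
    (h₁ : OverRoot x f P₁ c₁) (h₂ : OverRoot x f P₂ c₂) (hne : P₁ ≠ P₂) {u : ℤ}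
    (hu : (m : ℤ) = u * f.natDegree + 1) {a α β : ℕ}
    (ha : (a : ℤ) = ((f.natDegree : ℤ) - 3) * m + 1 + α) (hα : (α : ℤ) ≤ 2 * u - 1)
    (hβ : (β : ℤ) ≤ u - 1) : IsPureGap ![P₁, P₂] ![a, 1 + β] := by
  have hm := hC.two_le
  obtain ⟨hr, hu1⟩ := hC.natDegree_pos_of_eq hu
  have hr1 : (1 : ℤ) ≤ f.natDegree := by exact_mod_cast hr
  have ha0 : (0 : ℤ) ≤ a := Int.natCast_nonneg a
  -- For `r = 1` one has `m = u + 1`, and `a` would be at most `-2 m + 2 u = -2`.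
  have hr2 : 2 ≤ f.natDegree := by
    by_contra hlt
    have h1 : (f.natDegree : ℤ) = 1 := by omega
    rw [h1] at ha hu
    linarith
  have hr2' : (2 : ℤ) ≤ f.natDegree := by exact_mod_cast hr2
  have hαm : (α : ℤ) + 1 < m := by nlinarith
  have hβm : (β : ℤ) + 1 < m := by nlinarith
  have hαr : (f.natDegree : ℤ) * (1 + α) ≤ f.natDegree * (2 * u) :=
    mul_le_mul_of_nonneg_left (by linarith) (by linarith)
  have hβr : (f.natDegree : ℤ) * (1 + β) ≤ f.natDegree * u :=
    mul_le_mul_of_nonneg_left (by linarith) (by linarith)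
  have h12 : c₁ ≠ c₂ := by
    rintro rfl
    exact hne (hC.overRoot_unique h₁ h₂)
  have hs : ((f.natDegree - 2 : ℕ) : ℤ) = f.natDegree - 2 := by omega
  refine isPureGap_pair hne fun z hza hzb hz => ?_
  -- The exponent `s = r - 2` leaves order `m s - a = m - 1 - α` at `P₁`, strictly between `0` and
  -- `m`, and the degree bound becomes `m (r - 1) = m r - u r - 1`.
  obtain ⟨g, hd, hμ₁, hμ₂, h1', h2'⟩ :=
    hC.exists_expansion_root_root h₁ h₂ h12 (s := f.natDegree - 2) (by
      have : (a : ℤ) ≤ m * (f.natDegree - 2 : ℕ) := by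
        rw [hs, ha]
        linarith
      exact_mod_cast this) (by omega) hza hzb hz
  simp only [hs, ha, Nat.cast_add, Nat.cast_one] at hd hμ₁ hμ₂ h1' h2'
  constructor
  · intro h
    obtain ⟨j, hj, hjμ⟩ := h1' (h.trans (by rw [ha]))
    have h0 := eq_zero_of_mul_add_eq hjμ (by linarith)
    rw [h0] at hjμ
    have hj' : (j : ℤ) = m - 1 - α := by push_cast at hjμ; linarith
    have hd' := hd j hj
    have hμ' := hμ₂ j hj
    have hle := multiplicity_le_natDegree c₂ hj
    rw [hj'] at hd' hμ'
    -- If `g_j(c₂) ≠ 0`, the order at `P₂` gives `α ≤ β ≤ u - 1`, so `r j ≥ m r - u r` is too large.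
    -- Otherwise `deg g_j ≥ 1`, and the extra `m` compensates for `α` reaching `2 u - 1`.
    by_cases hk : multiplicity (Polynomial.X - Polynomial.C c₂) (g j) = 0
    · rw [hk] at hμ'
      have hαu : (α : ℤ) ≤ u - 1 := by push_cast at hμ'; linarith
      have hαr' : (f.natDegree : ℤ) * (1 + α) ≤ f.natDegree * u :=
        mul_le_mul_of_nonneg_left (by linarith) (by linarith)
      have h3 : (0 : ℤ) ≤ m * (g j).natDegree := by positivity
      nlinarith
    · have h3 : (1 : ℤ) ≤ (g j).natDegree := by omega
      have h4 : (m : ℤ) * 1 ≤ m * (g j).natDegree := by gcongr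
      nlinarith
  · intro h
    obtain ⟨j, hj, hjμ⟩ := h2' (by simpa using h)
    have h0 := eq_zero_of_mul_add_eq hjμ (by linarith)
    rw [h0] at hjμ
    have hj' : (j : ℤ) = m - (1 + β) := by push_cast at hjμ; linarith
    have hd' := hd j hj
    rw [hj'] at hd'
    have h3 : (0 : ℤ) ≤ m * (g j).natDegree := by positivity
    -- Again `r j = r (m - 1 - β) ≥ m r - u r`, which exceeds the degree bound by one.
    nlinarith

end AlgFunctionField.IsKummerCurve

theorem proposition4p3 {K F : Type*} [Field K] [Finite K] [Field F] [Algebra K F]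
    (p : ℕ) [CharP K p] (m r : ℕ) (hm : 2 ≤ m) (hpm : ¬ p ∣ m) (hmr : Nat.gcd m r = 1)
    (f : K[X]) (hf : f.Separable) (hr : f.natDegree = r)
    -- `F = K(x, y)` with `x` transcendental and `y ^ m = f(x)`
    (x y : F) (hx : Transcendental K x) (hxy : y ^ m = Polynomial.aeval x f)
    (hF : IntermediateField.adjoin K {x, y} = ⊤)
    (u : ℤ) (hu : (m : ℤ) = u * r + 1) :
    -- pure gaps at the pole of `x` and another totally ramified rational place
    (∀ Pinf P₁ : AlgFunctionField.Place K F, Pinf.IsPole x →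
      P₁.IsRational → P₁.IsTotallyRamified K⟮x⟯ → P₁ ≠ Pinf →
        (∀ a : ℕ, (a : ℤ) = ((r : ℤ) - 1) * m - 2 * r →
          AlgFunctionField.IsPureGap ![Pinf, P₁] ![a, 1]) ∧
        (∀ a b : ℕ, (a : ℤ) = ((r : ℤ) - 2) * m - r → 1 ≤ b → (b : ℤ) ≤ u + 1 →
          AlgFunctionField.IsPureGap ![Pinf, P₁] ![a, b])) ∧
    -- pure gaps at two distinct totally ramified rational places that are not poles of `x`
    (∀ P₁ P₂ : AlgFunctionField.Place K F,
      P₁.IsRational → P₁.IsTotallyRamified K⟮x⟯ → ¬ P₁.IsPole x →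
      P₂.IsRational → P₂.IsTotallyRamified K⟮x⟯ → ¬ P₂.IsPole x → P₁ ≠ P₂ →
        ∀ a α β : ℕ, (a : ℤ) = ((r : ℤ) - 3) * m + 1 + α →
          (α : ℤ) ≤ 2 * u - 1 → (β : ℤ) ≤ u - 1 →
          AlgFunctionField.IsPureGap ![P₁, P₂] ![a, 1 + β]) := by
  have hmK : (m : K) ≠ 0 := by rwa [Ne, CharP.cast_eq_zero_iff K p m]
  subst hr
  have hC : AlgFunctionField.IsKummerCurve x y m f :=
    ⟨hx, hm, hmK, hf.squarefree, hmr, hxy, hF⟩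
  refine ⟨fun Pinf P₁ hinf hrat hram hne => ?_, fun P₁ P₂ hrat₁ hram₁ hp₁ hrat₂ hram₂ hp₂ hne => ?_⟩
  -- As `x` has only one pole, `P₁ ≠ Pinf` already makes `P₁` a finite place.
  · obtain ⟨c, hc⟩ := hC.exists_overRoot hrat hram fun h => hne (hC.pole_unique h hinf)
    exact ⟨fun a ha => hC.isPureGap_pole_root_one hinf hc hne (hC.natDegree_pos_of_eq hu).1 ha,
      fun a b ha hb1 hbu => hC.isPureGap_pole_root hinf hc hne hu ha hb1 hbu⟩
  · obtain ⟨c₁, hc₁⟩ := hC.exists_overRoot hrat₁ hram₁ hp₁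
    obtain ⟨c₂, hc₂⟩ := hC.exists_overRoot hrat₂ hram₂ hp₂
    exact fun a α β ha hα hβ => hC.isPureGap_root_root hc₁ hc₂ hne hu ha hα hβ
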